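/- Let $k$ be an algebraically closed field of characteristic $0$, let $V=k^5$, and let $\mathbb P^4=\mathbb P(V)$ be the projective space of $1$-dimensional subspaces of $V$, with homogeneous coordinate ring $k[X_0,\dots,X_4]$ and canonical basis $e_0,\dots,e_4$ of $V$. For $i\ge 0$ and $l\in\mathbb Z$ let $\Omega^i(i+l)$ be realized as the image of the Koszul differential $\mathcal O_{\mathbb P^4}(l-1)\otimes\bigwedge^{i+1}V^\vee\to\mathcal O_{\mathbb P^4}(l)\otimes\bigwedge^iV^\vee$, $\alpha\mapsto\sum_t X_t\,(\alpha\llcorner e_t)$, where for $\omega\in\bigwedge^pV$ the contraction $\ast\llcorner\omega:\bigwedge^{p+q}V^\vee\to\bigwedge^qV^\vee$ is defined by $\langle\alpha\llcorner\omega,\eta\rangle=\langle\alpha,\omega\wedge\eta\rangle$. Contraction with $\omega\in\bigwedge^pV$ induces morphisms $\Omega^{p+q}(p+q)\to\Omega^q(q)$ (with $\Omega^0(0)=\mathcal O_{\mathbb P^4}$) and their twists. Let $\omega\in\bigwedge^2V$ and $v\in V$. (1) Let $\phi:\Omega^3(3)\oplus\Omega^2(2)\to\Omega^1(1)$ be the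 morphism on $\mathbb P^4$ defined by contraction with $\omega$ on the first summand and with $v$ on the second. The following are equivalent: (i) $\phi$ is an epimorphism; (ii) there is a $k$-basis $v_0,\dots,v_4$ of $V$ such that $\omega=v_0\wedge v_1+v_2\wedge v_3$ and $v=v_4$; (iii) $H^0(\phi(1)):H^0(\Omega^3(4)\oplus\Omega^2(3))\to H^0(\Omega^1(2))$ is surjective. (2) Let $\varepsilon:\Omega^2(2)\oplus\Omega^1(1)\to\mathcal O_{\mathbb P^4}$ be the morphism defined by contraction with $\omega$ on the first summand and with $v$ on the second, and assume that $\varepsilon$ is an epimorphism. Then $(\operatorname{Ker}\varepsilon)(1)=\operatorname{Ker}(\varepsilon(1))$ is globally generated if and only if there is a $k$-basis $v_0,\dots,v_4$ of $V$ such that $\omega=v_0\wedge v_1+v_2\wedge v_3$ and $v=v_4$. -/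

import Mathlib

open CategoryTheory Limits AlgebraicGeometry TopologicalSpace Opposite TopCat

universe u

namespace PnKoszul

noncomputable section

variable (k : Type u) [Field k] (n : ℕ)

/-- The homogeneous coordinate ring `S = k[X_0, …, X_n]` of `ℙⁿ`. -/
abbrev CoordRing : Type u := MvPolynomial (Fin (n + 1)) k

/-- The grading of `S` by the degree. -/
abbrev grading : ℕ → Submodule k (CoordRing k n) := MvPolynomial.homogeneousSubmodule (Fin (n + 1)) k

instance gradingGraded : GradedAlgebra (grading k n) := MvPolynomial.gradedAlgebra

/-- The projective space `ℙⁿ = Proj S` over `k`. -/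
abbrev ProjSpace : Scheme.{u} := Proj (grading k n)

/-- The vector space `V = k^{n+1}` whose lines are the `k`-points of `ℙⁿ`. -/
abbrev Vec : Type u := Fin (n + 1) → k

variable {k n} in
/-- The multiplicative set of the polynomials outside the homogeneous prime ideal of a point `x`
of `ℙⁿ`. -/
abbrev outside (x : ProjectiveSpectrum (grading k n)) : Submonoid (CoordRing k n) :=
  x.asHomogeneousIdeal.toIdeal.primeCompl

/-- The localization `S_x` of `S` at the homogeneous prime ideal of a point `x` of `ℙⁿ`. -/
abbrev Loc (x : ProjectiveSpectrum (grading k n)) : Type u :=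
  Localization (outside x)

variable {k n}

/-- `f` is given on all of `U` by one fraction `r / s` with `r`, `s` homogeneous and
`deg r = deg s + l`. -/
def IsFraction (l : ℤ) {U : Opens (ProjectiveSpectrum.top (grading k n))}
    (f : ∀ x : U, Loc k n x.1) : Prop :=
  ∃ (i j : ℕ) (_ : (i : ℤ) = j + l) (r s : CoordRing k n) (_ : r ∈ grading k n i) (_ : s ∈ grading k n j)
    (hs : ∀ x : U, s ∈ outside x.1),
    ∀ x : U, f x = Localization.mk r ⟨s, hs x⟩

variable (k n) in
/-- The local predicate of being locally a fraction of degree `l`; it cuts out the sections of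
`𝒪(l)`. -/
def isLocallyFraction (l : ℤ) :
    LocalPredicate fun x : ProjectiveSpectrum.top (grading k n) => Loc k n x :=
  PrelocalPredicate.sheafify
    { pred := fun f => IsFraction l f
      res := by
        rintro U V i f ⟨a, b, h, r, s, hr, hs, hn, e⟩
        exact ⟨a, b, h, r, s, hr, hs, fun x => hn (i x), fun x => e (i x)⟩ }

section scalar

variable {l : ℤ} {U : Opens (ProjectiveSpectrum.top (grading k n))}

lemma locFrac_zero : (isLocallyFraction k n l).pred (fun _ : U => 0) := by
  intro x
  obtain ⟨i, j, h⟩ : ∃ i j : ℕ, (i : ℤ) = j + l := ⟨l.toNat, (-l).toNat, by omega⟩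
  obtain ⟨t, ht⟩ : ∃ t : Fin (n + 1), (MvPolynomial.X t : CoordRing k n) ∉ x.1.asHomogeneousIdeal := by
    by_contra! hc
    refine x.1.not_irrelevant_le ?_
    intro f hf
    have h0 : MvPolynomial.coeff 0 f = 0 := by
      have h1 : GradedRing.proj (grading k n) 0 f = 0 := by
        simpa [HomogeneousIdeal.mem_irrelevant_iff] using hf
      have h2 : GradedRing.proj (grading k n) 0 f = MvPolynomial.homogeneousComponent 0 f := by
        rw [GradedRing.proj_apply]
        exact MvPolynomial.decomposition.decompose'_apply f 0
      rw [h2, MvPolynomial.homogeneousComponent_zero] at h1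
      simpa using h1
    have h3 : f ∈ Ideal.span ((MvPolynomial.X : Fin (n + 1) → CoordRing k n) '' Set.univ) := by
      rw [MvPolynomial.mem_ideal_span_X_image]
      intro m hm
      by_contra! hc'
      have hm0 : m = 0 := Finsupp.ext fun t => hc' t (Set.mem_univ _)
      rw [MvPolynomial.mem_support_iff, hm0] at hm
      exact hm h0
    refine (Ideal.span_le.2 ?_) h3
    rintro _ ⟨t, -, rfl⟩
    exact hc t
  refine ⟨U ⊓ ProjectiveSpectrum.basicOpen (grading k n) (MvPolynomial.X t : CoordRing k n),
    ⟨x.2, ht⟩, Opens.infLELeft _ _, i, j, h, 0, MvPolynomial.X t ^ j, zero_mem _, ?_, ?_, ?_⟩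
  · simpa using (MvPolynomial.isHomogeneous_X k t).pow j
  · intro y
    exact Submonoid.pow_mem _ y.2.2 _
  · intro y
    exact (Localization.mk_zero _).symm

lemma locFrac_add {f g : ∀ x : U, Loc k n x.1} (hf : (isLocallyFraction k n l).pred f)
    (hg : (isLocallyFraction k n l).pred g) :
    (isLocallyFraction k n l).pred (fun x => f x + g x) := by
  intro x
  obtain ⟨A, mA, iA, a, b, h, r, s, hr, hs, hn, e⟩ := hf x
  obtain ⟨B, mB, iB, a', b', h', r', s', hr', hs', hn', e'⟩ := hg x
  refine ⟨A ⊓ B, ⟨mA, mB⟩, Opens.infLELeft _ _ ≫ iA, a + b', b + b', by push_cast; omega,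
    s * r' + s' * r, s * s', ?_, SetLike.mul_mem_graded hs hs',
    fun y => Submonoid.mul_mem _ (hn ⟨y.1, y.2.1⟩) (hn' ⟨y.1, y.2.2⟩), ?_⟩
  · refine add_mem ?_ ?_
    · have := SetLike.mul_mem_graded hs hr'
      rwa [show b + a' = a + b' by omega] at this
    · have := SetLike.mul_mem_graded hs' hr
      rwa [show b' + a = a + b' by omega] at this
  · intro y
    exact (congrArg₂ (· + ·) (e ⟨y.1, y.2.1⟩) (e' ⟨y.1, y.2.2⟩)).trans (Localization.add_mk _ _ _ _)

lemma locFrac_neg {f : ∀ x : U, Loc k n x.1} (hf : (isLocallyFraction k n l).pred f) :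
    (isLocallyFraction k n l).pred (fun x => - f x) := by
  intro x
  obtain ⟨A, mA, iA, a, b, h, r, s, hr, hs, hn, e⟩ := hf x
  refine ⟨A, mA, iA, a, b, h, -r, s, neg_mem hr, hs, hn, fun y => ?_⟩
  have h1 := e y
  change f _ = _ at h1
  change - f _ = _
  rw [h1, Localization.neg_mk]

/-- A fraction of degree `l'` times a fraction of degree `l` is a fraction of degree `l' + l`. -/
lemma locFrac_mul {l' m : ℤ} (hm : l' + l = m) {f g : ∀ x : U, Loc k n x.1}
    (hf : (isLocallyFraction k n l').pred f) (hg : (isLocallyFraction k n l).pred g) :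
    (isLocallyFraction k n m).pred (fun x => f x * g x) := by
  intro x
  obtain ⟨A, mA, iA, a, b, h, r, s, hr, hs, hn, e⟩ := hf x
  obtain ⟨B, mB, iB, a', b', h', r', s', hr', hs', hn', e'⟩ := hg x
  refine ⟨A ⊓ B, ⟨mA, mB⟩, Opens.infLELeft _ _ ≫ iA, a + a', b + b', by push_cast; omega,
    r * r', s * s', SetLike.mul_mem_graded hr hr', SetLike.mul_mem_graded hs hs',
    fun y => Submonoid.mul_mem _ (hn ⟨y.1, y.2.1⟩) (hn' ⟨y.1, y.2.2⟩), ?_⟩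
  intro y
  exact (congrArg₂ (· * ·) (e ⟨y.1, y.2.1⟩) (e' ⟨y.1, y.2.2⟩)).trans (Localization.mk_mul _ _ _ _)

/-- Sections of the structure sheaf of `Proj S` are locally fractions of degree `0`. -/
lemma locFrac_structure (r : (ProjectiveSpectrum.Proj.structureSheaf (grading k n)).1.obj (op U)) :
    (isLocallyFraction k n 0).pred (fun x : U => (r.1 x).val) := by
  intro x
  obtain ⟨A, mA, iA, i, a, b, hn, e⟩ := r.2 x
  refine ⟨A, mA, iA, i, i, by simp, a.1, b.1, a.2, b.2, hn, fun y => ?_⟩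
  have h1 := e y
  change r.1 _ = _ at h1
  change (r.1 _).val = _
  rw [h1, HomogeneousLocalization.val_mk]

/-- A linear form is a section of `𝒪(1)`. -/
lemma locFrac_X (t : Fin (n + 1)) :
    (isLocallyFraction k n 1).pred
      (fun x : U => algebraMap (CoordRing k n) (Loc k n x.1) (MvPolynomial.X t)) := by
  intro x
  refine ⟨U, x.2, 𝟙 _, 1, 0, by simp, MvPolynomial.X t, 1, ?_, ?_, fun y => Submonoid.one_mem _,
    fun y => ?_⟩
  · simpa using MvPolynomial.isHomogeneous_X k t
  · exact SetLike.one_mem_graded _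
  · exact (Localization.mk_one_eq_algebraMap _).symm

lemma locFrac_sum {ι : Type*} (T : Finset ι) {f : ι → ∀ x : U, Loc k n x.1}
    (hf : ∀ i ∈ T, (isLocallyFraction k n l).pred (f i)) :
    (isLocallyFraction k n l).pred (fun x => ∑ i ∈ T, f i x) := by
  classical
  induction T using Finset.induction_on with
  | empty => simpa using locFrac_zero
  | insert a T ha ih =>
    simp only [Finset.sum_insert ha]
    exact locFrac_add (hf a (by simp)) (ih fun i hi => hf i (by simp [hi]))

end scalar

section sheaves

variable (W : Type u) [AddCommGroup W] [Module k W] (l : ℤ)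

variable (n) in
/-- The predicate on families of `k`-linear maps `W → S_x` that cuts out the sections of
`𝓗om_k(W, 𝒪(l))`: each vector of `W` is sent to a section of `𝒪(l)`. -/
def homPredicate : LocalPredicate fun x : ProjectiveSpectrum.top (grading k n) =>
    (W →ₗ[k] Loc k n x) where
  pred f := ∀ w : W, (isLocallyFraction k n l).pred (fun x => f x w)
  res i f h w := (isLocallyFraction k n l).res i _ (h w)
  locality f h w := (isLocallyFraction k n l).locality _ fun x => by
    obtain ⟨A, m, i, hA⟩ := h x
    exact ⟨A, m, i, hA w⟩

/-- The sections of `𝓗om_k(W, 𝒪(l))` over `U`. -/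
def homSections (U : Opens (ProjectiveSpectrum.top (grading k n))) :
    AddSubgroup (∀ x : U, W →ₗ[k] Loc k n x.1) where
  carrier := {f | (homPredicate n W l).pred f}
  zero_mem' _ := locFrac_zero
  add_mem' hf hg w := locFrac_add (hf w) (hg w)
  neg_mem' hf w := locFrac_neg (hf w)

/-- `𝓗om_k(W, 𝒪(l))` as a presheaf of abelian groups. -/
def homPresheaf : TopCat.Presheaf Ab.{u} (ProjSpace k n) where
  obj U := AddCommGrpCat.of (homSections (n := n) W l U.unop)
  map i := AddCommGrpCat.ofHom
    { toFun := fun f => ⟨fun x => f.1 (i.unop x), (homPredicate n W l).res i.unop f.1 f.2⟩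
      map_zero' := rfl
      map_add' := fun _ _ => rfl }

variable {W l} in
/-- A section `r` of the structure sheaf acts on `𝓗om_k(W, 𝒪(l))` by multiplication of the
values. -/
def homAct {U : (Opens (ProjectiveSpectrum.top (grading k n)))ᵒᵖ}
    (r : (ProjectiveSpectrum.Proj.structureSheaf (grading k n)).1.obj U)
    (f : homSections (n := n) W l U.unop) : homSections (n := n) W l U.unop :=
  ⟨fun x => LinearMap.mulLeft k (r.1 x).val ∘ₗ f.1 x,
    fun w => locFrac_mul (zero_add l) (locFrac_structure r) (f.2 w)⟩

instance homSectionsModule (U : (Opens (ProjectiveSpectrum.top (grading k n)))ᵒᵖ) :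
    Module ((ProjectiveSpectrum.Proj.structureSheaf (grading k n)).1.obj U)
      (homSections (n := n) W l U.unop) where
  smul := homAct
  one_smul f := by
    refine Subtype.ext (funext fun x => LinearMap.ext fun w => ?_)
    exact (congrArg (· * f.1 x w) (HomogeneousLocalization.val_one)).trans (one_mul _)
  mul_smul r s f := by
    refine Subtype.ext (funext fun x => LinearMap.ext fun w => ?_)
    exact (congrArg (· * f.1 x w) (HomogeneousLocalization.val_mul _ _)).trans (mul_assoc _ _ _)
  smul_zero r := by
    refine Subtype.ext (funext fun x => LinearMap.ext fun w => ?_)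
    exact mul_zero _
  smul_add r f g := by
    refine Subtype.ext (funext fun x => LinearMap.ext fun w => ?_)
    exact mul_add _ _ _
  add_smul r s f := by
    refine Subtype.ext (funext fun x => LinearMap.ext fun w => ?_)
    exact (congrArg (· * f.1 x w) (HomogeneousLocalization.val_add _ _)).trans (add_mul _ _ _)
  zero_smul f := by
    refine Subtype.ext (funext fun x => LinearMap.ext fun w => ?_)
    exact (congrArg (· * f.1 x w) (HomogeneousLocalization.val_zero)).trans (zero_mul _)

instance homModule (U : (Opens (ProjSpace k n))ᵒᵖ) :
    Module ((ProjSpace k n).ringCatSheaf.obj.obj U) ((homPresheaf (k := k) (n := n) W l).obj U) :=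
  homSectionsModule (k := k) (n := n) W l U

variable (n) in
/-- The sheaf of modules `𝓗om_k(W, 𝒪(l)) = 𝒪(l) ⊗ W^∨` on `ℙⁿ`, for a finite dimensional
`k`-vector space `W`. A section over `U` is a family of `k`-linear maps `W → S_x`, `x ∈ U`, that
sends each vector of `W` to a function that is locally a fraction of homogeneous polynomials
of degree `l`. -/
def homSheaf : (ProjSpace k n).Modules where
  val := PresheafOfModules.ofPresheaf (R := (ProjSpace k n).ringCatSheaf.obj)
    (homPresheaf (k := k) (n := n) W l) (fun _ _ _ _ _ => rfl)
  isSheaf := (TopCat.Presheaf.isSheaf_iff_isSheaf_comp (forget AddCommGrpCat) _).2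
    (TopCat.subpresheafToTypes.isSheaf (homPredicate (k := k) n W l))

variable (k n) in
/-- The invertible sheaf `𝒪(l) = 𝓗om_k(k, 𝒪(l))`. -/
def O : (ProjSpace k n).Modules := homSheaf n k l

variable {W} in
/-- The morphism `𝓗om_k(W, 𝒪(l)) ⟶ 𝓗om_k(W', 𝒪(l))` given by composition with a
`k`-linear map `W' → W`. -/
def precomp {W' : Type u} [AddCommGroup W'] [Module k W'] (g : W' →ₗ[k] W) :
    homSheaf (k := k) n W l ⟶ homSheaf (k := k) n W' l where
  val := PresheafOfModules.homMk
    { app := fun _ => AddCommGrpCat.ofHom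
        { toFun := fun f => ⟨fun x => f.1 x ∘ₗ g, fun w => f.2 (g w)⟩
          map_zero' := rfl
          map_add' := fun _ _ => rfl }
      naturality := fun _ _ _ => rfl }
    (fun _ _ _ => rfl)

end sheaves

section koszul

/-- Exterior multiplication `η ↦ ω ∧ η`, `⋀^q V → ⋀^r V`, by `ω ∈ ⋀^p V`, where `p + q = r`. -/
def wedge {p q r : ℕ} (h : p + q = r) (ω : ⋀[k]^p (Vec k n)) :
    ⋀[k]^q (Vec k n) →ₗ[k] ⋀[k]^r (Vec k n) :=
  (LinearMap.mulLeft k (ω : ExteriorAlgebra k (Vec k n))).restrict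
    fun η hη => by
      subst h
      exact SetLike.mul_mem_graded ω.2 hη

/-- A vector of `V` as an element of `⋀^1 V`. -/
def ofVec (v : Vec k n) : ⋀[k]^1 (Vec k n) := exteriorPower.ιMulti k 1 ![v]

variable (k n) in
/-- `𝒪(l) ⊗ ⋀^i V^∨ = 𝓗om_k(⋀^i V, 𝒪(l))`, where `⋀^i V^∨` is identified with the dual of `⋀^i V`
by the canonical pairing. -/
def E (i : ℕ) (l : ℤ) : (ProjSpace k n).Modules := homSheaf n (⋀[k]^i (Vec k n)) l

/-- The map on sections underlying the Koszul differential: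
`s ↦ (η ↦ ∑ t, X_t * s (e_t ∧ η))`. -/
def koszulFun (i : ℕ) (l : ℤ) {U : Opens (ProjectiveSpectrum.top (grading k n))}
    (f : homSections (n := n) (⋀[k]^(i + 1) (Vec k n)) (l - 1) U) :
    homSections (n := n) (⋀[k]^i (Vec k n)) l U :=
  ⟨fun x => ∑ t : Fin (n + 1),
      LinearMap.mulLeft k (algebraMap (CoordRing k n) (Loc k n x.1) (MvPolynomial.X t)) ∘ₗ
        f.1 x ∘ₗ wedge (add_comm 1 i) (ofVec (Pi.single t 1)),
    fun w => by
      simp only [LinearMap.sum_apply]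
      exact locFrac_sum _ fun t _ => locFrac_mul (add_sub_cancel 1 l) (locFrac_X t) (f.2 _)⟩

lemma koszulFun_apply (i : ℕ) (l : ℤ) {U : Opens (ProjectiveSpectrum.top (grading k n))}
    (f : homSections (n := n) (⋀[k]^(i + 1) (Vec k n)) (l - 1) U) (x : U)
    (w : ⋀[k]^i (Vec k n)) :
    (koszulFun i l f).1 x w = ∑ t : Fin (n + 1),
      algebraMap (CoordRing k n) (Loc k n x.1) (MvPolynomial.X t) *
        f.1 x (wedge (add_comm 1 i) (ofVec (Pi.single t 1)) w) := by
  simp [koszulFun]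

lemma koszulFun_add (i : ℕ) (l : ℤ) {U : Opens (ProjectiveSpectrum.top (grading k n))}
    (f g : homSections (n := n) (⋀[k]^(i + 1) (Vec k n)) (l - 1) U) :
    koszulFun i l (f + g) = koszulFun i l f + koszulFun i l g := by
  refine Subtype.ext (funext fun x => LinearMap.ext fun w => ?_)
  refine (koszulFun_apply i l _ x w).trans ?_
  refine Eq.trans ?_
    (congrArg₂ (· + ·) (koszulFun_apply i l f x w) (koszulFun_apply i l g x w)).symm
  refine Eq.trans ?_ Finset.sum_add_distrib
  exact Finset.sum_congr rfl fun t _ => mul_add _ _ _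

lemma koszulFun_smul (i : ℕ) (l : ℤ) {U : (Opens (ProjectiveSpectrum.top (grading k n)))ᵒᵖ}
    (r : (ProjectiveSpectrum.Proj.structureSheaf (grading k n)).1.obj U)
    (f : homSections (n := n) (⋀[k]^(i + 1) (Vec k n)) (l - 1) U.unop) :
    koszulFun i l (homAct r f) = homAct r (koszulFun i l f) := by
  refine Subtype.ext (funext fun x => LinearMap.ext fun w => ?_)
  refine (koszulFun_apply i l _ x w).trans ?_
  refine Eq.trans ?_ (congrArg ((r.1 x).val * ·) (koszulFun_apply i l f x w)).symm
  refine Eq.trans ?_ (Finset.mul_sum _ _ _).symm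
  exact Finset.sum_congr rfl fun t _ => mul_left_comm _ _ _

/-- The differential `𝒪(l - 1) ⊗ ⋀^{i+1} V^∨ ⟶ 𝒪(l) ⊗ ⋀^i V^∨` of the tautological Koszul complex.
In the fibre at a point `[v]` it is the contraction `α ↦ α ⌞ v`. -/
def koszulD (i : ℕ) (l : ℤ) : E k n (i + 1) (l - 1) ⟶ E k n i l where
  val := PresheafOfModules.homMk
    { app := fun _ => AddCommGrpCat.ofHom (AddMonoidHom.mk' (koszulFun i l) (koszulFun_add i l))
      naturality := fun _ _ _ => rfl }
    (fun _ r f => koszulFun_smul i l r f)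

/-- The contraction `α ↦ α ⌞ ω`, `𝒪(l) ⊗ ⋀^r V^∨ ⟶ 𝒪(l) ⊗ ⋀^q V^∨`, by `ω ∈ ⋀^p V`, where
`p + q = r`: it is given by `⟨α ⌞ ω, η⟩ = ⟨α, ω ∧ η⟩`. -/
def contractE {p q r : ℕ} (h : p + q = r) (ω : ⋀[k]^p (Vec k n)) (l : ℤ) :
    E k n r l ⟶ E k n q l :=
  precomp l (wedge h ω)

lemma ι_mul_comm {p : ℕ} (v : Vec k n) (ω : ExteriorAlgebra k (Vec k n))
    (hω : ω ∈ ⋀[k]^p (Vec k n)) :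
    ExteriorAlgebra.ι k v * ω = (-1 : k) ^ p • (ω * ExteriorAlgebra.ι k v) := by
  induction hω using Submodule.pow_induction_on_left' with
  | algebraMap r => simp [Algebra.commutes]
  | add x y i hx hy ihx ihy => rw [mul_add, ihx, ihy, add_mul, smul_add]
  | mem_mul m hm i x hx ih =>
    obtain ⟨w, rfl⟩ := hm
    have h1 : ExteriorAlgebra.ι k v * ExteriorAlgebra.ι k w =
        - (ExteriorAlgebra.ι k w * ExteriorAlgebra.ι k v) :=
      eq_neg_of_add_eq_zero_left (ExteriorAlgebra.ι_add_mul_swap v w)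
    rw [← mul_assoc, h1, neg_mul, mul_assoc, ih, mul_smul_comm, ← mul_assoc, pow_succ,
      mul_neg_one, neg_smul]

lemma coe_ofVec (v : Vec k n) :
    (ofVec v : ExteriorAlgebra k (Vec k n)) = ExteriorAlgebra.ι k v := by
  simp [ofVec, ExteriorAlgebra.ιMulti_apply]

lemma wedge_comm {p q r : ℕ} (h : p + q = r) (ω : ⋀[k]^p (Vec k n)) (v : Vec k n)
    (η : ⋀[k]^q (Vec k n)) :
    wedge (add_comm 1 r) (ofVec v) (wedge h ω η) =
      wedge (show p + (q + 1) = r + 1 by omega) ((-1 : k) ^ p • ω)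
        (wedge (add_comm 1 q) (ofVec v) η) := by
  apply Subtype.ext
  change (ofVec v : ExteriorAlgebra k (Vec k n)) * (ω * η) =
    ((-1 : k) ^ p • (ω : ExteriorAlgebra k (Vec k n))) * (ofVec v * η)
  rw [coe_ofVec, ← mul_assoc, ι_mul_comm v _ ω.2, smul_mul_assoc, smul_mul_assoc, mul_assoc]

/-- The contraction by `ω ∈ ⋀^p V` commutes with the Koszul differentials up to `(-1)^p`. -/
lemma contractE_koszulD {p q r : ℕ} (h : p + q = r) (ω : ⋀[k]^p (Vec k n)) (l : ℤ) :
    koszulD r l ≫ contractE h ω l =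
      contractE (show p + (q + 1) = r + 1 by omega) ((-1 : k) ^ p • ω) (l - 1) ≫ koszulD q l := by
  refine Scheme.Modules.hom_ext _ _ fun U => ?_
  ext f
  refine Subtype.ext (funext fun x => LinearMap.ext fun w => ?_)
  refine (koszulFun_apply r l f x (wedge h ω w)).trans ?_
  refine Eq.trans ?_ (koszulFun_apply q l _ x w).symm
  exact Finset.sum_congr rfl fun t _ => congrArg (_ * f.1 x ·) (wedge_comm h ω _ w)

variable (k n) in
/-- `Ω^i(i + l)` on `ℙⁿ`: the image of the Koszul differential
`𝒪(l - 1) ⊗ ⋀^{i+1} V^∨ ⟶ 𝒪(l) ⊗ ⋀^i V^∨`. -/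
def Omega (i : ℕ) (l : ℤ) : (ProjSpace k n).Modules := image (koszulD (k := k) (n := n) i l)

/-- The morphism `Ω^r(r + l) ⟶ Ω^q(q + l)` induced by the contraction by `ω ∈ ⋀^p V`, `p + q = r`;
it is the twist by `l` of the morphism `Ω^r(r) ⟶ Ω^q(q)`. -/
def contract {p q r : ℕ} (h : p + q = r) (ω : ⋀[k]^p (Vec k n)) (l : ℤ) :
    Omega k n r l ⟶ Omega k n q l :=
  image.map (Arrow.homMk (f := Arrow.mk (koszulD r l)) (g := Arrow.mk (koszulD q l))
    (contractE (show p + (q + 1) = r + 1 by omega) ((-1 : k) ^ p • ω) (l - 1))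
    (contractE h ω l) (contractE_koszulD h ω l).symm)

/-- The morphism `Ω^p(p + l) ⟶ 𝒪(l)` given by the contraction `α ↦ ⟨α, ω⟩` by `ω ∈ ⋀^p V`;
it is the twist by `l` of the morphism `Ω^p(p) ⟶ 𝒪`. -/
def contractO {p : ℕ} (ω : ⋀[k]^p (Vec k n)) (l : ℤ) : Omega k n p l ⟶ O k n l :=
  image.ι (koszulD p l) ≫ precomp l (LinearMap.toSpanSingleton k _ ω)

/-- A sheaf of modules is globally generated if it is generated by some family of its global
sections. -/
def GloballyGenerated {X : Scheme.{u}} (M : X.Modules) : Prop :=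
  Nonempty (SheafOfModules.GeneratingSections (R := X.ringCatSheaf) M)

variable (k) in
/-- `Ω^3(3 + l) ⊕ Ω^2(2 + l) ⟶ Ω^1(1 + l)` on `ℙ⁴`, the contraction with `ω ∈ ⋀^2 V` and `v ∈ V`. -/
def phi (ω : ⋀[k]^2 (Vec k 4)) (v : Vec k 4) (l : ℤ) :
    Omega k 4 3 l ⊞ Omega k 4 2 l ⟶ Omega k 4 1 l :=
  biprod.desc (contract (show 2 + 1 = 3 by rfl) ω l) (contract (show 1 + 1 = 2 by rfl) (ofVec v) l)

variable (k) in
/-- `Ω^2(2 + l) ⊕ Ω^1(1 + l) ⟶ 𝒪(l)` on `ℙ⁴`, the contraction with `ω ∈ ⋀^2 V` and `v ∈ V`. -/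
def epsilon (ω : ⋀[k]^2 (Vec k 4)) (v : Vec k 4) (l : ℤ) :
    Omega k 4 2 l ⊞ Omega k 4 1 l ⟶ O k 4 l :=
  biprod.desc (contractO ω l) (contractO (ofVec v) l)

end koszul

end

end PnKoszul

/-! The linear algebra is a dichotomy. If `(ω, v)` is not in normal form, there are independent
vectors x, u with x∧u∧ω = 0 and x∧u∧v = 0 (`exists_plane_of_not_normal_form`). In the normal form, η
↦ (ω∧η, v∧η) is injective on ⋀²V (`wedge_two_injective`), so it has a left inverse.

Part (1). A section of Ω^{q+1} is killed by the tautological vector, so at [x] it vanishes on every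
multiple of x. Given a plane as above, ω∧u and v∧u are multiples of x, so every section in the image
of φ, paired with u, vanishes at [x]. An explicit section of Ω^1, global after the twist by 1, does
not. Hence (i) and (iii) each force the normal form. Conversely, the left inverse dualizes to a lift
through φ of the Koszul epimorphism from 𝒪(l-1)⊗⋀²V^∨ onto Ω^1(1+l) (`exists_lift_phi`), which gives
(i). It also gives (iii), since in characteristic 0 every global section of Ω^{q+1}(q+2) is the
differential of a constant form (`exists_toOmega_constForm_eq`).

Part (2), necessity. Global sections of Ker ε(1) are pairs of constant forms (A, B) with A(y∧ω) +
B(y∧v) = 0 for all y. For a plane x, u choose η, w with x∧η = u∧ω and x∧w = u∧v. Contraction with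
(η, w) sends global sections of the kernel to linear forms vanishing at [x], so global generation
makes all local sections vanish there. Applied to local Koszul syzygies, this shows that the images
of x and u under y ↦ (y∧ω, y∧v) are proportional (`pairing_mul_comm`). That map is injective because
ε is an epimorphism (`eq_zero_of_epi_epsilon`), which contradicts the independence of x and u.

Part (2), sufficiency. The pairs of forms satisfying the relation above make up a trivial sheaf
mapping to Ker ε(1). This map is an epimorphism: a local section of the kernel lifts to a pair (a,
b) for which y ↦ a(y∧ω) + b(y∧v) is a Koszul cycle. The cycle is locally a boundary, and the left
inverse turns a primitive into exact corrections of a and b (`exists_correction`). -/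

namespace PnKoszul

noncomputable section

/-! ### Bivectors of a five-dimensional space relative to a vector -/

section normalForm

open Module

variable {k : Type u} [Field k]

local notation "V5" => (Fin 5 → k)

lemma mul_ι_anticomm {V : Type*} [AddCommGroup V] [Module k V] (a b : V) :
    ExteriorAlgebra.ι k b * ExteriorAlgebra.ι k a =
      -(ExteriorAlgebra.ι k a * ExteriorAlgebra.ι k b) :=
  eq_neg_of_add_eq_zero_left (ExteriorAlgebra.ι_add_mul_swap b a)

lemma ι_mul_ι_mul_swap {V : Type*} [AddCommGroup V] [Module k V] (a b : V)
    (z : ExteriorAlgebra k V) :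
    ExteriorAlgebra.ι k b * (ExteriorAlgebra.ι k a * z) =
      -(ExteriorAlgebra.ι k a * (ExteriorAlgebra.ι k b * z)) := by
  rw [← mul_assoc, mul_ι_anticomm a b, neg_mul, mul_assoc]

lemma ι_mul_ι_mul_self {V : Type*} [AddCommGroup V] [Module k V] (a : V)
    (z : ExteriorAlgebra k V) :
    ExteriorAlgebra.ι k a * (ExteriorAlgebra.ι k a * z) = 0 := by
  rw [← mul_assoc, ExteriorAlgebra.ι_sq_zero, zero_mul]

/-- A bivector in the span of three vectors is decomposable. -/
lemma exists_decomposable_of_three {V : Type*} [AddCommGroup V] [Module k V] (x y z : V)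
    (p q r : k) :
    ∃ a c : V, (∀ φ : Dual k V, φ x = 0 → φ y = 0 → φ z = 0 → φ a = 0 ∧ φ c = 0) ∧
      p • (ExteriorAlgebra.ι k x * ExteriorAlgebra.ι k y) +
        q • (ExteriorAlgebra.ι k x * ExteriorAlgebra.ι k z) +
        r • (ExteriorAlgebra.ι k y * ExteriorAlgebra.ι k z) =
      ExteriorAlgebra.ι k a * ExteriorAlgebra.ι k c := by
  by_cases hp : p = 0
  · refine ⟨q • x + r • y, z, fun φ hx hy hz => by simp [hx, hy, hz], ?_⟩
    simp [hp, add_mul]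
  -- The factor p x - r z supplies both the x∧y and the y∧z terms; q/p then adjusts x∧z.
  · refine ⟨p • x - r • z, y + (q / p) • z, fun φ hx hy hz => by simp [hx, hy, hz], ?_⟩
    simp only [map_add, map_sub, map_smul, mul_add, sub_mul, smul_mul_assoc, mul_smul_comm,
      ExteriorAlgebra.ι_sq_zero, mul_ι_anticomm y z, smul_sub, smul_smul, smul_zero,
      div_mul_cancel₀ _ hp]
    module

/-- The coordinates of a bivector with respect to a basis. -/
lemma exists_bivector_coords {ι V : Type*} [Fintype ι] [AddCommGroup V] [Module k V]
    (b : Basis ι k V) {ω : ExteriorAlgebra k V} (hω : ω ∈ ⋀[k]^2 V) :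
    ∃ c : ι → ι → k,
      ω = ∑ i, ∑ j, c i j • (ExteriorAlgebra.ι k (b i) * ExteriorAlgebra.ι k (b j)) := by
  rw [show ⋀[k]^2 V = LinearMap.range (ExteriorAlgebra.ι k) * LinearMap.range (ExteriorAlgebra.ι k)
    from pow_two _] at hω
  induction hω using Submodule.mul_induction_on' with
  | mem_mul_mem m hm n hn =>
    obtain ⟨m, rfl⟩ := hm
    obtain ⟨n, rfl⟩ := hn
    refine ⟨fun i j => b.repr m i * b.repr n j, ?_⟩
    conv_lhs => rw [← b.sum_repr m, ← b.sum_repr n]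
    simp only [map_sum, map_smul, Finset.sum_mul_sum, smul_mul_smul_comm]
  | add x hx y hy ihx ihy =>
    obtain ⟨c, rfl⟩ := ihx
    obtain ⟨d, rfl⟩ := ihy
    exact ⟨fun i j => c i j + d i j, by simp [add_smul, Finset.sum_add_distrib]⟩

/-- Modulo `b 4` the shifts disappear, and `w`, `a`, `c` lie in the span of `b 1`, `b 2`, `b 3`,
which is independent of `b 0`. The shifts are there to absorb the term of ω divisible by `b 4`. -/
lemma linearIndependent_of_triple (b : Basis (Fin 5) k V5) {w a c : V5}
    (hw : b.coord 0 w = 0 ∧ b.coord 4 w = 0) (ha : b.coord 0 a = 0 ∧ b.coord 4 a = 0)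
    (hc : b.coord 0 c = 0 ∧ b.coord 4 c = 0) (h : LinearIndependent k ![w, a, c])
    (s₀ s₁ s₂ s₃ : k) :
    LinearIndependent k
      ![b 0 + s₀ • b 4, w + s₁ • b 4, a + s₂ • b 4, c + s₃ • b 4, b 4] := by
  rw [Fintype.linearIndependent_iff] at h ⊢
  intro g hg
  simp only [Fin.sum_univ_five, Matrix.cons_val] at hg
  have h0 := congrArg (b.coord 0) hg
  have h4 := congrArg (b.coord 4) hg
  simp only [Basis.coord_apply] at hw ha hc
  simp [hw, ha, hc] at h0 h4
  rw [h0] at hg h4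
  have h5 : g 4 = -(g 1 * s₁ + g 2 * s₂ + g 3 * s₃) := by linear_combination h4
  have h3 := h ![g 1, g 2, g 3] (by
    simp only [Fin.sum_univ_three, Matrix.cons_val]
    rw [h5] at hg
    rw [← hg]
    module)
  have e1 := h3 0
  have e2 := h3 1
  have e3 := h3 2
  simp only [Matrix.cons_val] at e1 e2 e3
  intro i
  fin_cases i <;> simp [h0, e1, e2, e3, h5]

/-- The normal form of a bivector `ω` of `k⁵` relative to a vector `b 4`. -/
lemma bivector_normal_form (b : Basis (Fin 5) k V5) {ω : ExteriorAlgebra k V5}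
    (hω : ω ∈ ⋀[k]^2 V5) :
    (∃ d : Basis (Fin 5) k V5, d 4 = b 4 ∧
      ω = ExteriorAlgebra.ι k (d 0) * ExteriorAlgebra.ι k (d 1) +
        ExteriorAlgebra.ι k (d 2) * ExteriorAlgebra.ι k (d 3)) ∨
    ∃ a c z : V5, b.coord 4 a = 0 ∧
      ω = ExteriorAlgebra.ι k a * ExteriorAlgebra.ι k c +
        ExteriorAlgebra.ι k (b 4) * ExteriorAlgebra.ι k z := by
  have key : ∃ w z : V5, ∃ p q r : k, (b.coord 0 w = 0 ∧ b.coord 4 w = 0) ∧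
      ω = ExteriorAlgebra.ι k (b 0) * ExteriorAlgebra.ι k w +
        (p • (ExteriorAlgebra.ι k (b 1) * ExteriorAlgebra.ι k (b 2)) +
        q • (ExteriorAlgebra.ι k (b 1) * ExteriorAlgebra.ι k (b 3)) +
        r • (ExteriorAlgebra.ι k (b 2) * ExteriorAlgebra.ι k (b 3))) +
        ExteriorAlgebra.ι k (b 4) * ExteriorAlgebra.ι k z := by
    obtain ⟨t, rfl⟩ := exists_bivector_coords b hω
    -- `z` collects all terms involving `b 4`, `w` the remaining ones involving `b 0`; what is left
    -- is a bivector in three vectors.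
    refine ⟨(t 0 1 - t 1 0) • b 1 + (t 0 2 - t 2 0) • b 2 + (t 0 3 - t 3 0) • b 3,
      (t 4 0 - t 0 4) • b 0 + (t 4 1 - t 1 4) • b 1 + (t 4 2 - t 2 4) • b 2 +
        (t 4 3 - t 3 4) • b 3, t 1 2 - t 2 1, t 1 3 - t 3 1, t 2 3 - t 3 2,
        by simp, ?_⟩
    simp only [Fin.sum_univ_five, map_add, map_smul, mul_add, mul_smul_comm,
      ExteriorAlgebra.ι_sq_zero, smul_zero]
    rw [mul_ι_anticomm (b 0) (b 1), mul_ι_anticomm (b 0) (b 2), mul_ι_anticomm (b 0) (b 3),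
      mul_ι_anticomm (b 0) (b 4), mul_ι_anticomm (b 1) (b 2), mul_ι_anticomm (b 1) (b 3),
      mul_ι_anticomm (b 1) (b 4), mul_ι_anticomm (b 2) (b 3), mul_ι_anticomm (b 2) (b 4),
      mul_ι_anticomm (b 3) (b 4)]
    module
  obtain ⟨w, z, p, q, r, hw, rfl⟩ := key
  obtain ⟨a, c, hac, e⟩ := exists_decomposable_of_three (b 1) (b 2) (b 3) p q r
  have hac0 := hac (b.coord 0) (by simp) (by simp) (by simp)
  have hac4 := hac (b.coord 4) (by simp) (by simp) (by simp)
  rw [e]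
  by_cases hli : LinearIndependent k ![w, a, c]
  · left
    have hli' := linearIndependent_of_triple b hw ⟨hac0.1, hac4.1⟩ ⟨hac0.2, hac4.2⟩ hli
    have hcard : Fintype.card (Fin 5) = finrank k V5 := by simp
    obtain ⟨s, hz⟩ : ∃ s : Fin 5 → k,
        z = s 0 • b 0 + s 1 • w + s 2 • a + s 3 • c + s 4 • b 4 := by
      have hli0 : LinearIndependent k ![b 0, w, a, c, b 4] := by simpa using hli' 0 0 0 0
      refine ⟨(basisOfLinearIndependentOfCardEqFinrank hli0 hcard).repr z, ?_⟩
      refine ((basisOfLinearIndependentOfCardEqFinrank hli0 hcard).sum_repr z).symm.trans ?_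
      rw [coe_basisOfLinearIndependentOfCardEqFinrank]
      exact Fin.sum_univ_five _
    -- Since (b₀ + αb₄)∧(w + βb₄) = b₀∧w + b₄∧(αw - βb₀), these shifts produce exactly b₄∧z.
    refine ⟨basisOfLinearIndependentOfCardEqFinrank (hli' (s 1) (-s 0) (s 3) (-s 2)) hcard,
      by simp, ?_⟩
    simp only [coe_basisOfLinearIndependentOfCardEqFinrank, Matrix.cons_val]
    rw [hz]
    simp only [map_add, map_smul, mul_add, add_mul, mul_smul_comm, smul_mul_assoc,
      ExteriorAlgebra.ι_sq_zero, smul_zero]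
    rw [mul_ι_anticomm (b 0) (b 4), mul_ι_anticomm w (b 4), mul_ι_anticomm a (b 4),
      mul_ι_anticomm c (b 4)]
    module
  · right
    rw [Fintype.linearIndependent_iff] at hli
    push Not at hli
    obtain ⟨g, hg, i, hi⟩ := hli
    simp only [Fin.sum_univ_three, Matrix.cons_val] at hg
    by_cases h0 : g 0 = 0
    -- The relation involves only `a` and `c`, so a∧c = 0.
    · refine ⟨b 0, w, z, by simp, ?_⟩
      have hz : ExteriorAlgebra.ι k a * ExteriorAlgebra.ι k c = 0 := by
        rw [h0, zero_smul, zero_add] at hg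
        have h1 := congrArg (fun y => ExteriorAlgebra.ι k a * ExteriorAlgebra.ι k y) hg
        have h2 := congrArg (fun y => ExteriorAlgebra.ι k y * ExteriorAlgebra.ι k c) hg
        simp [mul_add, add_mul] at h1 h2
        fin_cases i
        · exact absurd h0 hi
        · exact h2.resolve_left hi
        · exact h1.resolve_left hi
      rw [hz, add_zero]
    -- Here `w` is a combination of `a` and `c`, so b₀∧w + a∧c is a bivector in the three vectors `b
    -- 0`, `a`, `c`.
    · obtain ⟨a', c', hac', e'⟩ :=
        exists_decomposable_of_three (b 0) a c (-(g 1 / g 0)) (-(g 2 / g 0)) 1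
      refine ⟨a', c', z, (hac' (b.coord 4) (by simp) hac4.1 hac4.2).1, ?_⟩
      rw [← e']
      have hw' : w = (-(g 1 / g 0)) • a + (-(g 2 / g 0)) • c := by
        have h3 : (g 0)⁻¹ • (g 0 • w + g 1 • a + g 2 • c) = 0 := by rw [hg, smul_zero]
        simp only [smul_add, smul_smul, inv_mul_cancel₀ h0, one_smul] at h3
        rw [add_assoc] at h3
        rw [eq_neg_of_add_eq_zero_left h3, div_eq_inv_mul, div_eq_inv_mul]
        module
      rw [hw']
      simp only [map_add, map_smul, mul_add, mul_smul_comm, one_smul]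

lemma exists_basis_last_eq {v : V5} (hv : v ≠ 0) : ∃ b : Basis (Fin 5) k V5, b 4 = v := by
  have hli : LinearIndepOn k id ({v} : Set V5) :=
    (linearIndepOn_singleton_iff (R := k) (v := id)).2 hv
  let B := Basis.extend hli
  have : Fintype (hli.extend (Set.subset_univ _)) := FiniteDimensional.fintypeBasisIndex B
  have hcard : Fintype.card (hli.extend (Set.subset_univ _)) = Fintype.card (Fin 5) := by
    rw [← finrank_eq_card_basis B]; simp
  let e := Fintype.equivOfCardEq hcard
  have hmem : v ∈ hli.extend (Set.subset_univ _) := hli.subset_extend _ (by simp)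
  refine ⟨B.reindex (e.trans (Equiv.swap (e ⟨v, hmem⟩) 4)), ?_⟩
  simp [B]

/-- If `(ω, v)` is not in the normal form, then some plane kills `ω` and `v`. -/
lemma exists_plane_of_not_normal_form (ω : ⋀[k]^2 V5) (v : V5)
    (h : ¬ ∃ b : Basis (Fin 5) k V5,
      ω = exteriorPower.ιMulti k 2 ![b 0, b 1] + exteriorPower.ιMulti k 2 ![b 2, b 3] ∧
        v = b 4) :
    ∃ (x u : V5) (f g : Dual k V5), f x = 1 ∧ f u = 0 ∧ g u = 1 ∧
      ExteriorAlgebra.ι k x * (ExteriorAlgebra.ι k u * (ω : ExteriorAlgebra k V5)) = 0 ∧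
      ExteriorAlgebra.ι k x * (ExteriorAlgebra.ι k u * ExteriorAlgebra.ι k v) = 0 := by
  obtain ⟨b, hb⟩ : ∃ b : Basis (Fin 5) k V5, v = 0 ∨ b 4 = v := by
    by_cases hv : v = 0
    · exact ⟨Pi.basisFun k _, Or.inl hv⟩
    · exact (exists_basis_last_eq hv).imp fun _ => Or.inr
  rcases bivector_normal_form b ω.2 with ⟨d, hd, e⟩ | ⟨a, c, z, ha, e⟩
  · rcases hb with rfl | rfl
    -- With v = 0 only ω has to be killed, and d₀∧d₂ kills both of its terms.
    · refine ⟨d 0, d 2, d.coord 0, d.coord 2, by simp, by simp, by simp, ?_, by simp⟩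
      rw [e, mul_add, mul_add, ι_mul_ι_mul_swap (d 0) (d 2), mul_neg, ι_mul_ι_mul_self,
        ι_mul_ι_mul_self, mul_zero, neg_zero, add_zero]
    · refine absurd ⟨d, ?_, hd.symm⟩ h
      apply Subtype.ext
      rw [e]
      simp [exteriorPower.ιMulti_apply_coe, ExteriorAlgebra.ιMulti_apply]
  · obtain ⟨u, hu4, hu0, hu⟩ : ∃ u, b.coord 4 u = 0 ∧ u ≠ 0 ∧
        ExteriorAlgebra.ι k u * (ExteriorAlgebra.ι k a * ExteriorAlgebra.ι k c) = 0 := by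
      by_cases h0 : a = 0
      · exact ⟨b 0, by simp, b.ne_zero 0, by simp [h0]⟩
      · exact ⟨a, ha, h0, ι_mul_ι_mul_self _ _⟩
    obtain ⟨g, hg⟩ : ∃ g : Dual k V5, g u = 1 := by
      obtain ⟨i, hi⟩ : ∃ i, u i ≠ 0 := by
        by_contra! hc
        exact hu0 (funext hc)
      exact ⟨(u i)⁻¹ • LinearMap.proj i, by simp [hi]⟩
    refine ⟨b 4, u, b.coord 4, g, by simp, hu4, hg, ?_, ?_⟩
    · rw [e, mul_add, hu, zero_add, ι_mul_ι_mul_swap (b 4) u, mul_neg, ι_mul_ι_mul_self,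
        neg_zero]
    · rcases hb with rfl | rfl
      · simp
      · rw [mul_ι_anticomm (b 4) u, mul_neg, ι_mul_ι_mul_self, neg_zero]

end normalForm

/-! ### Contraction of multivectors by linear forms -/

section interior

open Module

variable {k : Type u} [Field k]

lemma ι_mem_exteriorPower_one {V : Type*} [AddCommGroup V] [Module k V] (w : V) :
    ExteriorAlgebra.ι k w ∈ ⋀[k]^1 V := by
  rw [show ⋀[k]^1 V = LinearMap.range (ExteriorAlgebra.ι k) from pow_one _]
  exact LinearMap.mem_range_self _ w

lemma contractLeft_mem {V : Type*} [AddCommGroup V] [Module k V] (d : Dual k V) {p : ℕ}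
    {η : ExteriorAlgebra k V} (hη : η ∈ ⋀[k]^(p + 1) V) :
    CliffordAlgebra.contractLeft d η ∈ ⋀[k]^p V := by
  -- The induction starts in degree 0, where m - 1 is truncated; the extra clause records that the
  -- contraction is zero there.
  suffices h : ∀ (m : ℕ) (η : ExteriorAlgebra k V), η ∈ ⋀[k]^m V →
      (m = 0 → CliffordAlgebra.contractLeft d η = 0) ∧
        CliffordAlgebra.contractLeft d η ∈ ⋀[k]^(m - 1) V from (h _ η hη).2
  intro m η hη
  induction hη using Submodule.pow_induction_on_left' with
  | algebraMap r => simp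
  | add x y i hx hy ihx ihy =>
    exact ⟨fun h => by rw [map_add, ihx.1 h, ihy.1 h, add_zero],
      by rw [map_add]; exact add_mem ihx.2 ihy.2⟩
  | mem_mul m hm i x hx ih =>
    obtain ⟨w, rfl⟩ := hm
    refine ⟨fun h => absurd h (Nat.succ_ne_zero i), ?_⟩
    rw [Nat.succ_sub_one, CliffordAlgebra.contractLeft_ι_mul]
    refine sub_mem (Submodule.smul_mem _ _ hx) ?_
    rcases i with - | i
    · rw [ih.1 rfl, mul_zero]
      exact zero_mem _
    · rw [add_comm]
      exact SetLike.mul_mem_graded (A := fun i : ℕ => ⋀[k]^i V)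
        (ι_mem_exteriorPower_one w) ih.2

lemma exists_ι_eq_of_mem {V : Type*} [AddCommGroup V] [Module k V] {η : ExteriorAlgebra k V}
    (hη : η ∈ ⋀[k]^1 V) : ∃ y : V, ExteriorAlgebra.ι k y = η := by
  rwa [show ⋀[k]^1 V = LinearMap.range (ExteriorAlgebra.ι k) from pow_one _] at hη

/-- If `x ∧ η = 0` and `d x = 1`, then `η` is the product of `x` and the contraction of `η`. -/
lemma eq_ι_mul_contractLeft {V : Type*} [AddCommGroup V] [Module k V] {d : Dual k V} {x : V}
    (hd : d x = 1) {η : ExteriorAlgebra k V} (h : ExteriorAlgebra.ι k x * η = 0) :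
    η = ExteriorAlgebra.ι k x * CliffordAlgebra.contractLeft d η := by
  have h1 := congrArg (CliffordAlgebra.contractLeft d) h
  rw [CliffordAlgebra.contractLeft_ι_mul, map_zero, hd, one_smul] at h1
  exact sub_eq_zero.1 h1

variable {n : ℕ}

/-- Contraction of multivectors by a linear form. -/
def interior (d : Dual k (Vec k n)) (p : ℕ) : ⋀[k]^(p + 1) (Vec k n) →ₗ[k] ⋀[k]^p (Vec k n) :=
  (CliffordAlgebra.contractLeft (Q := (0 : QuadraticForm k (Vec k n))) d).restrict
    fun _ hη => contractLeft_mem d hη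

lemma coe_interior (d : Dual k (Vec k n)) (p : ℕ) (η : ⋀[k]^(p + 1) (Vec k n)) :
    (interior d p η : ExteriorAlgebra k (Vec k n)) =
      CliffordAlgebra.contractLeft d (η : ExteriorAlgebra k (Vec k n)) := rfl

lemma coe_wedge {p q r : ℕ} (h : p + q = r) (ω : ⋀[k]^p (Vec k n)) (η : ⋀[k]^q (Vec k n)) :
    (wedge h ω η : ExteriorAlgebra k (Vec k n)) = ω * η := rfl

lemma coe_wedge_ofVec {q r : ℕ} (h : 1 + q = r) (x : Vec k n) (η : ⋀[k]^q (Vec k n)) :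
    (wedge h (ofVec x) η : ExteriorAlgebra k (Vec k n)) = ExteriorAlgebra.ι k x * η := by
  rw [coe_wedge, coe_ofVec]

lemma interior_wedge (d : Dual k (Vec k n)) (x : Vec k n) (p : ℕ)
    (η : ⋀[k]^(p + 1) (Vec k n)) :
    interior d (p + 1) (wedge (add_comm 1 (p + 1)) (ofVec x) η) =
      d x • η - wedge (add_comm 1 p) (ofVec x) (interior d p η) := by
  apply Subtype.ext
  rw [coe_interior, coe_wedge_ofVec, CliffordAlgebra.contractLeft_ι_mul]
  rw [AddSubgroupClass.coe_sub, coe_wedge_ofVec, coe_interior]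
  rfl

/-- Euler's identity for multivectors. -/
lemma sum_wedge_interior (p : ℕ) (η : ⋀[k]^(p + 1) (Vec k n)) :
    ∑ t : Fin (n + 1), wedge (add_comm 1 p) (ofVec (Pi.single t 1))
      (interior (LinearMap.proj t) p η) = ((p + 1 : ℕ) : k) • η := by
  suffices h : ∀ (m : ℕ) (η : ExteriorAlgebra k (Vec k n)), η ∈ ⋀[k]^m (Vec k n) →
      ∑ t : Fin (n + 1), ExteriorAlgebra.ι k (Pi.single t 1 : Vec k n) *
        CliffordAlgebra.contractLeft (LinearMap.proj t : Dual k (Vec k n)) η = (m : k) • η by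
    apply Subtype.ext
    have h1 := h _ η.1 η.2
    rw [AddSubmonoidClass.coe_finsetSum]
    simp only [coe_wedge_ofVec, coe_interior]
    exact h1
  intro m η hη
  induction hη using Submodule.pow_induction_on_left' with
  | algebraMap r => simp
  | add x y i hx hy ihx ihy =>
    simp only [map_add, mul_add, Finset.sum_add_distrib, ihx, ihy, smul_add]
  | mem_mul m hm i x hx ih =>
    obtain ⟨w, rfl⟩ := hm
    simp only [CliffordAlgebra.contractLeft_ι_mul, mul_sub, Finset.sum_sub_distrib]
    have h1 : ∑ t : Fin (n + 1), ExteriorAlgebra.ι k (Pi.single t 1 : Vec k n) *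
        ((LinearMap.proj t : Dual k (Vec k n)) w • x) = ExteriorAlgebra.ι k w * x := by
      conv_rhs => rw [← LinearMap.sum_single_apply (fun _ => k) w]
      rw [map_sum, Finset.sum_mul]
      refine Finset.sum_congr rfl fun t _ => ?_
      rw [mul_smul_comm, ← smul_mul_assoc, ← map_smul]
      congr 2
      ext j
      simp [Pi.single_apply]
    have h2 : ∑ t : Fin (n + 1), ExteriorAlgebra.ι k (Pi.single t 1 : Vec k n) *
        (ExteriorAlgebra.ι k w * CliffordAlgebra.contractLeft
          (LinearMap.proj t : Dual k (Vec k n)) x) = - ((i : k) • (ExteriorAlgebra.ι k w * x)) := by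
      rw [← mul_smul_comm, ← ih, Finset.mul_sum, ← Finset.sum_neg_distrib]
      exact Finset.sum_congr rfl fun t _ => ι_mul_ι_mul_swap _ _ _
    refine (congrArg₂ (· - ·) h1 h2).trans ?_
    rw [sub_neg_eq_add, Nat.cast_succ, add_smul, one_smul]
    exact add_comm _ _

end interior

/-! ### Injectivity of multiplication by the normal form -/

section injective

open Module

variable {k : Type u} [Field k] (b : Basis (Fin 5) k (Fin 5 → k))

/-- The summand b₀∧b₁ of ω detects the coordinates 2 and 3 of `y`, and b₂∧b₃ detects 0 and 1. Each
is read off by four successive contractions with coordinate forms, which annihilate the other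
summand. -/
lemma eq_smul_of_mul_eq_zero {y : Fin 5 → k}
    (h : (ExteriorAlgebra.ι k (b 0) * ExteriorAlgebra.ι k (b 1) +
      ExteriorAlgebra.ι k (b 2) * ExteriorAlgebra.ι k (b 3)) *
        (ExteriorAlgebra.ι k (b 4) * ExteriorAlgebra.ι k y) = 0) :
    y = b.coord 4 y • b 4 := by
  have hy := b.sum_repr y
  rw [Fin.sum_univ_five] at hy
  rw [← hy] at h
  simp only [add_mul, mul_assoc, map_add, map_smul, mul_add, mul_smul_comm,
    ExteriorAlgebra.ι_sq_zero] at h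
  have e (i j l m : Fin 5) := congrArg (CliffordAlgebra.contractLeft (b.coord i)) (congrArg
    (CliffordAlgebra.contractLeft (b.coord j)) (congrArg
      (CliffordAlgebra.contractLeft (b.coord l)) (congrArg
        (CliffordAlgebra.contractLeft (b.coord m)) h)))
  have e2 := e 2 4 1 0
  have e3 := e 3 4 1 0
  have e0 := e 0 4 3 2
  have e1 := e 1 4 3 2
  simp [CliffordAlgebra.contractLeft_ι_mul, CliffordAlgebra.contractLeft_ι] at e0 e1 e2 e3
  conv_lhs => rw [← hy]
  simp [e0, e1, e2, e3]

variable {b} {ω : ⋀[k]^2 (Vec k 4)} {v : Vec k 4}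

lemma coe_normal_form
    (hω : ω = exteriorPower.ιMulti k 2 ![b 0, b 1] + exteriorPower.ιMulti k 2 ![b 2, b 3]) :
    (ω : ExteriorAlgebra k (Vec k 4)) = ExteriorAlgebra.ι k (b 0) * ExteriorAlgebra.ι k (b 1) +
      ExteriorAlgebra.ι k (b 2) * ExteriorAlgebra.ι k (b 3) := by
  rw [hω]
  simp [exteriorPower.ιMulti_apply_coe, ExteriorAlgebra.ιMulti_apply]

/-- From v∧η = 0 one gets η = v∧y; then ω∧v∧y = 0 forces y to be a multiple of v, so η = 0. -/
lemma wedge_two_injective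
    (hω : ω = exteriorPower.ιMulti k 2 ![b 0, b 1] + exteriorPower.ιMulti k 2 ![b 2, b 3])
    (hv : v = b 4) :
    Function.Injective ((wedge (show 2 + 2 = 4 by rfl) ω).prod
      (wedge (show 1 + 2 = 3 by rfl) (ofVec v))) := by
  rw [injective_iff_map_eq_zero]
  rintro ⟨η, hη⟩ h
  rw [LinearMap.prod_apply, Prod.mk_eq_zero] at h
  have h1 : (ω : ExteriorAlgebra k (Vec k 4)) * η = 0 := congrArg Subtype.val h.1
  have h2 : ExteriorAlgebra.ι k v * η = 0 :=
    (coe_wedge_ofVec _ v ⟨η, hη⟩).symm.trans (congrArg Subtype.val h.2)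
  have h3 := eq_ι_mul_contractLeft (d := b.coord 4) (by simp [hv]) h2
  obtain ⟨y, hy⟩ := exists_ι_eq_of_mem (contractLeft_mem (b.coord 4) hη)
  rw [← hy, hv] at h3
  rw [h3, coe_normal_form hω] at h1
  have h4 := eq_smul_of_mul_eq_zero b h1
  apply Subtype.ext
  change η = 0
  rw [h3, h4, map_smul, mul_smul_comm, ExteriorAlgebra.ι_sq_zero, smul_zero]

end injective

/-! ### Subsheaves of modules; epimorphisms, images and kernels on sections -/

section subsheaf

variable {X : Scheme.{u}} {M N : X.Modules}

/-- A family of submodules is local if membership can be tested on an open cover. -/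
def IsLocalSubmodule (P : PresheafOfModules.Submodule N.val) : Prop :=
  ∀ (U : X.Opens) (s : Γ(N, U)),
    (∀ x ∈ U, ∃ (V : X.Opens) (i : V ⟶ U), x ∈ V ∧ N.presheaf.map i.op s ∈ P.obj (op V)) →
      s ∈ P.obj (op U)

/-- Sections that agree locally are equal. -/
lemma eq_of_forall_exists_map_eq {U : X.Opens} {s t : Γ(N, U)}
    (h : ∀ x ∈ U, ∃ (V : X.Opens) (i : V ⟶ U), x ∈ V ∧
      N.presheaf.map i.op s = N.presheaf.map i.op t) : s = t := by
  choose V i hx e using h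
  refine TopCat.Sheaf.eq_of_locally_eq' ⟨N.presheaf, N.isSheaf⟩ (fun x : U => V x.1 x.2) U
    (fun x => i x.1 x.2) (fun x hxU => Opens.mem_iSup.2 ⟨⟨x, hxU⟩, hx x hxU⟩) s t
    fun x => e x.1 x.2

lemma map_app (f : M ⟶ N) {U V : X.Opens} (i : V ⟶ U) (s : Γ(M, U)) :
    N.presheaf.map i.op (f.app U s) = f.app V (M.presheaf.map i.op s) :=
  (PresheafOfModules.naturality_apply f.val i.op s).symm

lemma map_map {U V W : X.Opens} (i : V ⟶ U) (j : W ⟶ V) (s : Γ(N, U)) :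
    N.presheaf.map j.op (N.presheaf.map i.op s) = N.presheaf.map (j ≫ i).op s := by
  rw [op_comp, Functor.map_comp, ConcreteCategory.comp_apply]

/-- Sections of `P` glue uniquely in `N`, and locality puts the glued section back into `P`. -/
lemma isSheaf_of_isLocalSubmodule {P : PresheafOfModules.Submodule N.val}
    (hP : IsLocalSubmodule P) :
    TopCat.Presheaf.IsSheaf (X := (X : TopCat)) P.toPresheafOfModules.presheaf := by
  rw [TopCat.Presheaf.isSheaf_iff_isSheafUniqueGluing]
  intro ι U sf hsf
  have hι : ∀ (V W : X.Opens) (i : V ⟶ W) (z : P.obj (op W)),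
      (P.toPresheafOfModules.presheaf.map i.op z).1 = N.presheaf.map i.op z.1 :=
    fun V W i z => rfl
  obtain ⟨s, hs, hu⟩ := TopCat.Sheaf.existsUnique_gluing ⟨N.presheaf, N.isSheaf⟩ U
    (fun i => (sf i).1) (fun i j => congrArg Subtype.val (hsf i j))
  refine ⟨⟨s, hP _ s fun x hx => ?_⟩, fun i => Subtype.ext (hs i), fun t ht => ?_⟩
  · obtain ⟨i, hi⟩ := Opens.mem_iSup.1 hx
    refine ⟨U i, Opens.leSupr U i, hi, ?_⟩
    have h := hs i
    change N.presheaf.map (Opens.leSupr U i).op s = _ at h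
    rw [h]
    exact (sf i).2
  · exact Subtype.ext (hu t.1 fun i => congrArg Subtype.val (ht i))

/-- The sheaf of modules given by a local family of submodules. -/
def subsheaf (P : PresheafOfModules.Submodule N.val) (hP : IsLocalSubmodule P) : X.Modules :=
  { val := P.toPresheafOfModules
    isSheaf := isSheaf_of_isLocalSubmodule hP }

/-- The inclusion of a subsheaf of modules. -/
def subsheafι (P : PresheafOfModules.Submodule N.val) (hP : IsLocalSubmodule P) :
    subsheaf P hP ⟶ N :=
  { val := P.ι }

lemma mono_of_app_injective (f : M ⟶ N) (h : ∀ U, Function.Injective (f.app U)) : Mono f := by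
  refine ⟨fun g₁ g₂ e => Scheme.Modules.hom_ext _ _ fun U => ?_⟩
  ext s
  exact h U (congrArg (fun φ => Scheme.Modules.Hom.app φ U s) e)

instance (P : PresheafOfModules.Submodule N.val) (hP : IsLocalSubmodule P) :
    Mono (subsheafι P hP) :=
  mono_of_app_injective _ fun _ => Subtype.val_injective

lemma subsheafι_app_mem (P : PresheafOfModules.Submodule N.val) (hP : IsLocalSubmodule P)
    (U : X.Opens) (s : Γ(subsheaf P hP, U)) : (subsheafι P hP).app U s ∈ P.obj (op U) :=
  s.2

/-- A morphism with values in a subsheaf lifts to the subsheaf. -/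
def liftSubsheaf (P : PresheafOfModules.Submodule N.val) (hP : IsLocalSubmodule P) (f : M ⟶ N)
    (hf : ∀ U (s : Γ(M, U)), f.app U s ∈ P.obj (op U)) : M ⟶ subsheaf P hP :=
  { val := PresheafOfModules.homMk
      { app := fun U => AddCommGrpCat.ofHom
          { toFun := fun s => (⟨f.app U.unop s, hf U.unop s⟩ : P.obj U)
            map_zero' := Subtype.ext (map_zero (f.app U.unop).hom)
            map_add' := fun a b => Subtype.ext (map_add (f.app U.unop).hom a b) }
        naturality := fun U V i => by
          ext s
          exact Subtype.ext (PresheafOfModules.naturality_apply f.val i s) }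
      (fun U r m => Subtype.ext (Scheme.Modules.Hom.app_smul f r m)) }

lemma liftSubsheaf_ι (P : PresheafOfModules.Submodule N.val) (hP : IsLocalSubmodule P) (f : M ⟶ N)
    (hf : ∀ U (s : Γ(M, U)), f.app U s ∈ P.obj (op U)) :
    liftSubsheaf P hP f hf ≫ subsheafι P hP = f := by
  refine Scheme.Modules.hom_ext _ _ fun U => ?_
  ext s
  rfl

/-- The inclusion is both mono and epi, hence an isomorphism. Applied to a subsheaf through which a
morphism factors, this converts categorical epimorphy into statements about sections. -/
lemma mem_of_epi_subsheafι (P : PresheafOfModules.Submodule N.val) (hP : IsLocalSubmodule P)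
    [Epi (subsheafι P hP)] {U : X.Opens} (s : Γ(N, U)) : s ∈ P.obj (op U) := by
  have : IsIso (subsheafι P hP) := isIso_of_mono_of_epi _
  have h : s = (subsheafι P hP).app U ((inv (subsheafι P hP)).app U s) := by
    have e : inv (subsheafι P hP) ≫ subsheafι P hP = 𝟙 N := IsIso.inv_hom_id _
    exact (congrArg (fun φ => Scheme.Modules.Hom.app φ U s) e).symm
  rw [h]
  exact subsheafι_app_mem P hP U _

/-- The image of an epimorphism lies in no proper subsheaf. -/
lemma mem_of_epi (P : PresheafOfModules.Submodule N.val) (hP : IsLocalSubmodule P) (f : M ⟶ N)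
    [Epi f] (hf : ∀ U (s : Γ(M, U)), f.app U s ∈ P.obj (op U)) {U : X.Opens} (s : Γ(N, U)) :
    s ∈ P.obj (op U) := by
  have : Epi (subsheafι P hP) := epi_of_epi_fac (liftSubsheaf_ι P hP f hf)
  exact mem_of_epi_subsheafι P hP s

/-- The sections that are locally in the image of a morphism. -/
def localImage (f : M ⟶ N) : PresheafOfModules.Submodule N.val where
  obj U :=
    { carrier := {s | ∀ x ∈ U.unop, ∃ (V : X.Opens) (i : V ⟶ U.unop) (t : Γ(M, V)), x ∈ V ∧
        f.app V t = N.presheaf.map i.op s}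
      zero_mem' := fun x hx => ⟨U.unop, 𝟙 _, 0, hx, by
        rw [map_zero]; exact (map_zero _).symm⟩
      add_mem' := fun {a b} ha hb x hx => by
        obtain ⟨V, i, t, hV, e⟩ := ha x hx
        obtain ⟨W, j, t', hW, e'⟩ := hb x hx
        refine ⟨V ⊓ W, Opens.infLELeft V W ≫ i, M.presheaf.map (Opens.infLELeft V W).op t +
          M.presheaf.map (Opens.infLERight V W).op t', ⟨hV, hW⟩, ?_⟩
        rw [map_add, ← map_app, ← map_app, e, e']
        exact (congrArg₂ (· + ·) (map_map i (Opens.infLELeft V W) a)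
          (map_map j (Opens.infLERight V W) b)).trans
          (map_add (N.presheaf.map (Opens.infLELeft V W ≫ i).op).hom a b).symm
      smul_mem' := fun r a ha x hx => by
        obtain ⟨V, i, t, hV, e⟩ := ha x hx
        refine ⟨V, i, (X.presheaf.map i.op r : Γ(X, V)) • t, hV, ?_⟩
        rw [Scheme.Modules.Hom.app_smul, e]
        exact (Scheme.Modules.map_smul N i r a).symm }
  map {U V} g s hs x hx := by
    obtain ⟨W, i, t, hW, e⟩ := hs x (g.unop.le hx)
    refine ⟨W ⊓ V.unop, Opens.infLERight _ _, M.presheaf.map (Opens.infLELeft _ _).op t,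
      ⟨hW, hx⟩, ?_⟩
    rw [← map_app, e]
    exact (map_map i (Opens.infLELeft W V.unop) s).trans
      (map_map g.unop (Opens.infLERight W V.unop) s).symm

lemma isLocalSubmodule_localImage (f : M ⟶ N) : IsLocalSubmodule (localImage f) := by
  intro U s h x hx
  obtain ⟨V, i, hV, h'⟩ := h x hx
  obtain ⟨W, j, t, hW, e⟩ := h' x hV
  refine ⟨W, j ≫ i, t, hW, ?_⟩
  rw [e, map_map]

/-- An epimorphism of sheaves of modules is locally surjective. -/
lemma exists_local_preimage (f : M ⟶ N) [Epi f] {U : X.Opens} (s : Γ(N, U)) {x : X}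
    (hx : x ∈ U) : ∃ (V : X.Opens) (i : V ⟶ U) (t : Γ(M, V)), x ∈ V ∧
      f.app V t = N.presheaf.map i.op s :=
  mem_of_epi (localImage f) (isLocalSubmodule_localImage f) f
    (fun U s x hx => ⟨U, 𝟙 _, s, hx, by simp⟩) s x hx

lemma epi_of_local_preimage (f : M ⟶ N) (h : ∀ (U : X.Opens) (s : Γ(N, U)), ∀ x ∈ U,
    ∃ (V : X.Opens) (i : V ⟶ U) (t : Γ(M, V)), x ∈ V ∧ f.app V t = N.presheaf.map i.op s) :
    Epi f := by
  refine ⟨fun {K} g₁ g₂ e => Scheme.Modules.hom_ext _ _ fun U => ?_⟩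
  ext s
  refine eq_of_forall_exists_map_eq (N := K) fun x hx => ?_
  obtain ⟨V, i, t, hV, h'⟩ := h U s x hx
  refine ⟨V, i, hV, ?_⟩
  rw [map_app, map_app, ← h']
  exact congrArg (fun φ => Scheme.Modules.Hom.app φ V t) e

/-- The sections that are mapped to zero by a morphism. -/
def sectionsKer (f : M ⟶ N) : PresheafOfModules.Submodule M.val where
  obj U := LinearMap.ker (f.val.app U).hom
  map {U V} g s hs := by
    rw [LinearMap.mem_ker] at hs
    change f.val.app V (M.val.map g s) = 0
    rw [PresheafOfModules.naturality_apply]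
    exact (congrArg (N.val.map g) hs).trans (map_zero (N.val.map g).hom)

lemma isLocalSubmodule_sectionsKer (f : M ⟶ N) : IsLocalSubmodule (sectionsKer f) := by
  intro U s h
  change f.app U s = 0
  refine eq_of_forall_exists_map_eq fun x hx => ?_
  obtain ⟨V, i, hV, h'⟩ := h x hx
  refine ⟨V, i, hV, ?_⟩
  rw [map_app, map_zero]
  exact h'

/-- A section that is mapped to zero is a section of the kernel. -/
lemma exists_kernel_section (f : M ⟶ N) {U : X.Opens} (s : Γ(M, U)) (hs : f.app U s = 0) :
    ∃ t : Γ(kernel f, U), (kernel.ι f).app U t = s := by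
  -- The explicit subsheaf of killed sections maps to the abstract kernel by the universal property.
  have h0 : subsheafι (sectionsKer f) (isLocalSubmodule_sectionsKer f) ≫ f = 0 := by
    refine Scheme.Modules.hom_ext _ _ fun U => ?_
    ext s
    exact s.2
  let s' : Γ(subsheaf (sectionsKer f) (isLocalSubmodule_sectionsKer f), U) :=
    (⟨s, hs⟩ : (sectionsKer f).obj (op U))
  exact ⟨(kernel.lift f _ h0).app U s',
    congrArg (fun φ => Scheme.Modules.Hom.app φ U s') (kernel.lift_ι f _ h0)⟩

lemma app_kernel_ι (f : M ⟶ N) {U : X.Opens} (t : Γ(kernel f, U)) :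
    f.app U ((kernel.ι f).app U t) = 0 :=
  congrArg (fun φ => Scheme.Modules.Hom.app φ U t) (kernel.condition f)

lemma app_injective_of_mono (f : M ⟶ N) [Mono f] (U : X.Opens) :
    Function.Injective (f.app U) := by
  have h : Mono ((Scheme.Modules.toPresheaf X).map f) := inferInstance
  have h2 : Mono (((Scheme.Modules.toPresheaf X).map f).app (op U)) := inferInstance
  exact (AddCommGrpCat.mono_iff_injective _).1 h2

lemma biprod_section_ext {A B : X.Modules} {U : X.Opens} {s t : Γ(A ⊞ B, U)}
    (h₁ : Scheme.Modules.Hom.app (biprod.fst : A ⊞ B ⟶ A) U s =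
      Scheme.Modules.Hom.app (biprod.fst : A ⊞ B ⟶ A) U t)
    (h₂ : Scheme.Modules.Hom.app (biprod.snd : A ⊞ B ⟶ B) U s =
      Scheme.Modules.Hom.app (biprod.snd : A ⊞ B ⟶ B) U t) : s = t := by
  have h (z : Γ(A ⊞ B, U)) : z =
      Scheme.Modules.Hom.app (biprod.inl : A ⟶ A ⊞ B) U
        (Scheme.Modules.Hom.app (biprod.fst : A ⊞ B ⟶ A) U z) +
      Scheme.Modules.Hom.app (biprod.inr : B ⟶ A ⊞ B) U
        (Scheme.Modules.Hom.app (biprod.snd : A ⊞ B ⟶ B) U z) :=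
    (congrArg (fun φ => Scheme.Modules.Hom.app φ U z)
      (biprod.total (X := A) (Y := B))).symm
  rw [h s, h t, h₁, h₂]

lemma biprod_desc_app {A B : X.Modules} (f : A ⟶ N) (g : B ⟶ N) {U : X.Opens}
    (s : Γ(A ⊞ B, U)) : (biprod.desc f g).app U s =
      f.app U (Scheme.Modules.Hom.app (biprod.fst : A ⊞ B ⟶ A) U s) +
        g.app U (Scheme.Modules.Hom.app (biprod.snd : A ⊞ B ⟶ B) U s) :=
  congrArg (fun φ => Scheme.Modules.Hom.app φ U s) biprod.desc_eq

end subsheaf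

/-! ### Global generation -/

section generated

variable {X : Scheme.{u}} {M : X.Modules}

/-- If a sheaf is globally generated, its global sections lie in no proper subsheaf. -/
lemma mem_of_globallyGenerated (h : GloballyGenerated M) (P : PresheafOfModules.Submodule M.val)
    (hP : IsLocalSubmodule P) (hg : ∀ s : Γ(M, ⊤), s ∈ P.obj (op ⊤)) {U : X.Opens}
    (s : Γ(M, U)) : s ∈ P.obj (op U) := by
  obtain ⟨σ⟩ := h
  let s' : σ.I → SheafOfModules.sections (R := X.ringCatSheaf) (subsheaf P hP) := fun i =>
    PresheafOfModules.sectionsMk (fun U => (⟨(σ.s i).1 U, by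
        have h1 := P.map_mem (homOfLE (le_top (a := U.unop))).op (hg ((σ.s i).1 (op ⊤)))
        have h2 := (σ.s i).2 (homOfLE (le_top (a := U.unop))).op
        exact Eq.subst (motive := fun z => z ∈ P.obj U) h2 h1⟩ : P.obj U))
      fun U V f => Subtype.ext ((σ.s i).2 f)
  have e : (SheafOfModules.freeHomEquiv (R := X.ringCatSheaf) (subsheaf P hP)).symm s' ≫
      subsheafι P hP = σ.π := by
    refine (SheafOfModules.freeHomEquiv_symm_comp (R := X.ringCatSheaf) s'
      (subsheafι P hP)).trans ?_
    rfl
  have hπ : Epi (C := X.Modules) σ.π := σ.epi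
  have : Epi (subsheafι P hP) := epi_of_epi_fac (C := X.Modules) e
  exact mem_of_epi_subsheafι P hP s

/-- A sheaf is globally generated if a morphism out of it is determined by its values on a family
of global sections. -/
lemma globallyGenerated_of_hom_ext {I : Type u}
    (s : I → SheafOfModules.sections (R := X.ringCatSheaf) M)
    (h : ∀ (K : X.Modules) (g₁ g₂ : M ⟶ K),
      (∀ i, g₁.app ⊤ ((s i).1 (op ⊤)) = g₂.app ⊤ ((s i).1 (op ⊤))) → g₁ = g₂) :
    GloballyGenerated M := by
  refine ⟨⟨I, s, ⟨fun {K} g₁ g₂ e => h K g₁ g₂ fun i => ?_⟩⟩⟩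
  have h1 := SheafOfModules.freeHomEquiv_symm_comp (R := X.ringCatSheaf) s g₁
  have h2 := SheafOfModules.freeHomEquiv_symm_comp (R := X.ringCatSheaf) s g₂
  have h3 := (SheafOfModules.freeHomEquiv (R := X.ringCatSheaf) K).symm.injective
    (h1.symm.trans (e.trans h2))
  exact congrArg (fun z => (z i).1 (op ⊤)) h3

end generated

variable {k : Type u} [Field k] {n : ℕ}

/-! ### Sections of 𝒪(l) ⊗ W^∨ through their values -/

section value

variable {W : Type u} [AddCommGroup W] [Module k W] {l : ℤ} {U V : (ProjSpace k n).Opens}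

/-- The value of a section of `𝓗om_k(W, 𝒪(l))` at a point. -/
def value (s : Γ(homSheaf n W l, U)) (x : ProjectiveSpectrum (grading k n)) (hx : x ∈ U) :
    W →ₗ[k] Loc k n x :=
  (show homSections (n := n) W l U from s).1 ⟨x, hx⟩

/-- The section of `𝓗om_k(W, 𝒪(l))` with given values. -/
def mkSection (f : ∀ x : U, W →ₗ[k] Loc k n x.1)
    (h : ∀ w, (isLocallyFraction k n l).pred (U := U) fun x => f x w) : Γ(homSheaf n W l, U) :=
  (⟨f, h⟩ : homSections (n := n) W l U)

lemma section_ext {s t : Γ(homSheaf (k := k) n W l, U)}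
    (h : ∀ x (hx : x ∈ U) w, value s x hx w = value t x hx w) : s = t :=
  Subtype.ext (a1 := (show homSections (n := n) W l U from s))
    (funext fun x => LinearMap.ext fun w => h x.1 x.2 w)

lemma isLocallyFraction_value (s : Γ(homSheaf (k := k) n W l, U)) (w : W) :
    (isLocallyFraction k n l).pred (U := U) fun x => value s x.1 x.2 w :=
  (show homSections (n := n) W l U from s).2 w

lemma value_koszulD (i : ℕ) (s : Γ(E k n (i + 1) (l - 1), U)) (x) (hx : x ∈ U)
    (η : ⋀[k]^i (Vec k n)) :
    value ((koszulD i l).app U s) x hx η = ∑ t : Fin (n + 1),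
      algebraMap (CoordRing k n) (Loc k n x) (MvPolynomial.X t) *
        value s x hx (wedge (add_comm 1 i) (ofVec (Pi.single t 1)) η) :=
  koszulFun_apply i l (show homSections (n := n) _ (l - 1) U from s) ⟨x, hx⟩ η

/-- The section of `𝓗om_k(W, 𝒪(l))` that sends `w` to the fraction `G w / F`. -/
def fracSection {d e : ℕ} (hl : (d : ℤ) = e + l) (G : W →ₗ[k] CoordRing k n)
    (hG : ∀ w, G w ∈ grading k n d) (F : CoordRing k n) (hF : F ∈ grading k n e)
    (hU : ∀ x : U, F ∈ outside (k := k) (n := n) x.1) : Γ(homSheaf n W l, U) :=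
  mkSection (fun x =>
      LinearMap.mulLeft k (Localization.mk (1 : CoordRing k n) ⟨F, hU x⟩) ∘ₗ
        (Algebra.linearMap (CoordRing k n) (Loc k n x.1)).restrictScalars k ∘ₗ G) fun w x =>
    ⟨U, x.2, 𝟙 _, d, e, hl, G w, F, hG w, hF, hU, fun y => by
      change Localization.mk 1 _ * algebraMap (CoordRing k n) (Loc k n y.1) (G w) = _
      rw [← Localization.mk_one_eq_algebraMap, Localization.mk_mul, one_mul, mul_one]⟩

lemma value_fracSection {d e : ℕ} (hl : (d : ℤ) = e + l) (G : W →ₗ[k] CoordRing k n)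
    (hG : ∀ w, G w ∈ grading k n d) (F : CoordRing k n) (hF : F ∈ grading k n e)
    (hU : ∀ x : U, F ∈ outside (k := k) (n := n) x.1) (x) (hx : x ∈ U) (w : W) :
    value (fracSection hl G hG F hF hU) x hx w =
      Localization.mk (1 : CoordRing k n) ⟨F, hU ⟨x, hx⟩⟩ * algebraMap _ _ (G w) := rfl

end value

/-! ### Sections of Ω^i and their contractions -/

section omega

variable {l : ℤ} {U V : (ProjSpace k n).Opens}

/-- The section of `𝒪(l) ⊗ ⋀^i V^∨` underlying a section of `Ω^i(i + l)`. -/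
def omegaι {i : ℕ} (s : Γ(Omega k n i l, U)) : Γ(E k n i l, U) :=
  (image.ι (koszulD (k := k) (n := n) i l)).app U s

variable (k n) in
/-- The Koszul differential as an epimorphism onto its image `Ω^i(i + l)`. -/
def omegaπ (i : ℕ) (l : ℤ) : E k n (i + 1) (l - 1) ⟶ Omega k n i l :=
  factorThruImage (koszulD (k := k) (n := n) i l)

instance (i : ℕ) (l : ℤ) : Epi (omegaπ k n i l) :=
  inferInstanceAs (Epi (factorThruImage (koszulD (k := k) (n := n) i l)))

/-- The section of `Ω^i(i + l)` that is the Koszul differential of a section. -/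
def toOmega {i : ℕ} (s : Γ(E k n (i + 1) (l - 1), U)) : Γ(Omega k n i l, U) :=
  (omegaπ k n i l).app U s

lemma omegaι_toOmega {i : ℕ} (s : Γ(E k n (i + 1) (l - 1), U)) :
    omegaι (toOmega s) = (koszulD i l).app U s :=
  congrArg (fun φ => Scheme.Modules.Hom.app φ U s) (image.fac (koszulD (k := k) (n := n) i l))

lemma omegaι_injective {i : ℕ} :
    Function.Injective (omegaι : Γ(Omega k n i l, U) → Γ(E k n i l, U)) :=
  app_injective_of_mono (image.ι (koszulD (k := k) (n := n) i l)) U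

lemma omegaι_map {i : ℕ} (j : V ⟶ U) (s : Γ(Omega k n i l, U)) :
    omegaι ((Omega k n i l).presheaf.map j.op s) = (E k n i l).presheaf.map j.op (omegaι s) :=
  (map_app _ j s).symm

lemma exists_toOmega_eq {i : ℕ} (s : Γ(Omega k n i l, U)) {x : ProjSpace k n} (hx : x ∈ U) :
    ∃ (V : (ProjSpace k n).Opens) (j : V ⟶ U) (t : Γ(E k n (i + 1) (l - 1), V)), x ∈ V ∧
      toOmega t = (Omega k n i l).presheaf.map j.op s :=
  exists_local_preimage (omegaπ k n i l) s hx

lemma omegaπ_contract {p q r : ℕ} (h : p + q = r) (ω : ⋀[k]^p (Vec k n)) (l : ℤ) :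
    omegaπ k n r l ≫ contract h ω l =
      contractE (show p + (q + 1) = r + 1 by omega) ((-1 : k) ^ p • ω) (l - 1) ≫
        omegaπ k n q l := by
  unfold contract omegaπ
  exact image.factor_map (Arrow.homMk (f := Arrow.mk (koszulD r l)) (g := Arrow.mk (koszulD q l))
    (contractE (show p + (q + 1) = r + 1 by omega) ((-1 : k) ^ p • ω) (l - 1))
    (contractE h ω l) (contractE_koszulD h ω l).symm)

lemma contract_ι {p q r : ℕ} (h : p + q = r) (ω : ⋀[k]^p (Vec k n)) (l : ℤ) :
    contract h ω l ≫ image.ι (koszulD (k := k) (n := n) q l) =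
      image.ι (koszulD (k := k) (n := n) r l) ≫ contractE h ω l :=
  image.map_ι _

lemma omegaι_contract {p q r : ℕ} (h : p + q = r) (ω : ⋀[k]^p (Vec k n))
    (s : Γ(Omega k n r l, U)) :
    omegaι ((contract h ω l).app U s) = (contractE h ω l).app U (omegaι s) :=
  congrArg (fun φ => Scheme.Modules.Hom.app φ U s) (contract_ι h ω l)

lemma wedge_ofVec_ofVec_self {q : ℕ} (a b : Vec k n) (η : ⋀[k]^q (Vec k n)) :
    wedge (add_comm 1 (q + 1)) (ofVec a) (wedge (add_comm 1 q) (ofVec b) η) =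
      - wedge (add_comm 1 (q + 1)) (ofVec b) (wedge (add_comm 1 q) (ofVec a) η) := by
  apply Subtype.ext
  rw [coe_wedge_ofVec, coe_wedge_ofVec, Submodule.coe_neg, coe_wedge_ofVec, coe_wedge_ofVec]
  exact ι_mul_ι_mul_swap _ _ _

/-- The sections of `Ω^{q+1}` are killed by the contraction with the tautological vector. -/
lemma sum_value_omegaι {q : ℕ} [CharZero k] (s : Γ(Omega k n (q + 1) l, U)) (x) (hx : x ∈ U)
    (η : ⋀[k]^q (Vec k n)) :
    ∑ t : Fin (n + 1), algebraMap (CoordRing k n) (Loc k n x) (MvPolynomial.X t) *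
      value (omegaι s) x hx (wedge (add_comm 1 q) (ofVec (Pi.single t 1)) η) = 0 := by
  obtain ⟨V, j, t, hV, e⟩ := exists_toOmega_eq s hx
  have h1 (ζ) : value (omegaι s) x hx ζ = value ((koszulD (q + 1) l).app V t) x hV ζ := by
    rw [← omegaι_toOmega, e, omegaι_map]
    rfl
  simp only [h1, value_koszulD, Finset.mul_sum]
  -- The double sum pairs the symmetric X_a X_b with the antisymmetric e_a∧e_b, so it equals its own
  -- negative.
  have h2 : ∀ z : Loc k n x, z = -z → z = 0 := fun z hz => by
    have h3 : (2 : k) • z = 0 := by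
      rw [two_smul]
      nth_rw 1 [hz]
      exact neg_add_cancel z
    exact (smul_eq_zero.1 h3).resolve_left two_ne_zero
  apply h2
  conv_lhs => rw [Finset.sum_comm]
  rw [← Finset.sum_neg_distrib]
  refine Finset.sum_congr rfl fun a _ => ?_
  rw [← Finset.sum_neg_distrib]
  refine Finset.sum_congr rfl fun b _ => ?_
  rw [wedge_ofVec_ofVec_self, map_neg]
  ring

end omega

/-! ### Rational points of projective space and vanishing at them -/

section point

/-- The point of `ℙⁿ` given by a non-zero vector. -/
def point (x : Vec k n) (hx : x ≠ 0) : ProjectiveSpectrum (grading k n) where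
  asHomogeneousIdeal := (RingHom.ker (MvPolynomial.eval x)).homogeneousCore (grading k n)
  isPrime := Ideal.IsPrime.homogeneousCore (RingHom.ker_isPrime (MvPolynomial.eval x))
  not_irrelevant_le h := by
    apply hx
    funext t
    have h1 : (MvPolynomial.X t : CoordRing k n) ∈ HomogeneousIdeal.irrelevant (grading k n) :=
      HomogeneousIdeal.mem_irrelevant_of_mem (grading k n) one_pos
        ((MvPolynomial.mem_homogeneousSubmodule _ _).2 (MvPolynomial.isHomogeneous_X k t))
    have h2 := Ideal.toIdeal_homogeneousCore_le (grading k n) _ (h h1)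
    simpa [RingHom.mem_ker] using h2

lemma mem_point_iff (x : Vec k n) (hx : x ≠ 0) {d : ℕ} {r : CoordRing k n}
    (hr : r ∈ grading k n d) :
    r ∈ (point x hx).asHomogeneousIdeal.toIdeal ↔ MvPolynomial.eval x r = 0 :=
  ⟨fun h => Ideal.toIdeal_homogeneousCore_le (grading k n) _ h,
    fun h => Ideal.mem_homogeneousCore_of_homogeneous_of_mem ⟨d, hr⟩ h⟩

lemma algebraMap_smul' (p : ProjectiveSpectrum (grading k n)) (c : k) (r : CoordRing k n) :
    algebraMap (CoordRing k n) (Loc k n p) (c • r) = c • algebraMap (CoordRing k n) (Loc k n p) r := by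
  rw [Algebra.smul_def, Algebra.smul_def, map_mul, ← IsScalarTower.algebraMap_apply]

/-- The elements of `S_p` that vanish at `p`. -/
def vanishing (p : ProjectiveSpectrum (grading k n)) : Ideal (Loc k n p) :=
  p.asHomogeneousIdeal.toIdeal.map (algebraMap (CoordRing k n) (Loc k n p))

/-- The ideal `vanishing p` is the maximal ideal of the local ring S_p. -/
lemma algebraMap_mem_vanishing (p : ProjectiveSpectrum (grading k n)) {r : CoordRing k n} :
    algebraMap (CoordRing k n) (Loc k n p) r ∈ vanishing p ↔
      r ∈ p.asHomogeneousIdeal.toIdeal := by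
  rw [vanishing, Localization.AtPrime.map_eq_maximalIdeal]
  exact IsLocalization.AtPrime.to_map_mem_maximal_iff (Localization.AtPrime _) _ r

lemma isUnit_algebraMap {p : ProjectiveSpectrum (grading k n)} {r : CoordRing k n}
    (h : r ∈ outside p) : IsUnit (algebraMap (CoordRing k n) (Loc k n p) r) :=
  IsLocalization.map_units (Loc k n p) (⟨r, h⟩ : outside p)

lemma exists_X_mem_outside (p : ProjectiveSpectrum (grading k n)) :
    ∃ t : Fin (n + 1), (MvPolynomial.X t : CoordRing k n) ∈ outside p := by
  by_contra! hc
  refine p.not_irrelevant_le fun f hf => ?_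
  have h0 : MvPolynomial.coeff 0 f = 0 := by
    have h1 : GradedRing.proj (grading k n) 0 f = 0 := by
      simpa [HomogeneousIdeal.mem_irrelevant_iff] using hf
    have h2 : GradedRing.proj (grading k n) 0 f = MvPolynomial.homogeneousComponent 0 f :=
      MvPolynomial.decomposition.decompose'_apply f 0
    rw [h2, MvPolynomial.homogeneousComponent_zero] at h1
    simpa using h1
  have h3 : f ∈ Ideal.span ((MvPolynomial.X : Fin (n + 1) → CoordRing k n) '' Set.univ) := by
    rw [MvPolynomial.mem_ideal_span_X_image]
    intro m hm
    by_contra! hc'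
    have hm0 : m = 0 := Finsupp.ext fun t => hc' t (Set.mem_univ _)
    rw [MvPolynomial.mem_support_iff, hm0] at hm
    exact hm h0
  refine (Ideal.span_le.2 ?_) h3
  rintro _ ⟨t, -, rfl⟩
  by_contra h4
  exact hc t h4

lemma wedge_ofVec_eq_sum (x : Vec k n) {q : ℕ} (η : ⋀[k]^q (Vec k n)) :
    wedge (add_comm 1 q) (ofVec x) η =
      ∑ t : Fin (n + 1), x t • wedge (add_comm 1 q) (ofVec (Pi.single t 1)) η := by
  apply Subtype.ext
  rw [AddSubmonoidClass.coe_finsetSum]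
  simp only [Submodule.coe_smul, coe_wedge_ofVec]
  conv_lhs => rw [pi_eq_sum_univ' x]
  simp only [map_sum, map_smul, Finset.sum_mul, smul_mul_assoc]

/-- A linear map that is killed by the tautological vector vanishes at `p = [x]` on the multiples
of `x`. -/
lemma wedge_mem_vanishing (x : Vec k n) (hx : x ≠ 0) {q : ℕ}
    (φ : ⋀[k]^(q + 1) (Vec k n) →ₗ[k] Loc k n (point x hx)) (η : ⋀[k]^q (Vec k n))
    (h : ∑ t : Fin (n + 1), algebraMap (CoordRing k n) (Loc k n (point x hx)) (MvPolynomial.X t) *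
      φ (wedge (add_comm 1 q) (ofVec (Pi.single t 1)) η) = 0) :
    φ (wedge (add_comm 1 q) (ofVec x) η) ∈ vanishing (point x hx) := by
  obtain ⟨s, hs⟩ : ∃ s, x s ≠ 0 := by
    by_contra! hc
    exact hx (funext hc)
  have hXs : (MvPolynomial.X s : CoordRing k n) ∈ outside (point x hx) := by
    intro hmem
    rw [SetLike.mem_coe, mem_point_iff x hx ((MvPolynomial.mem_homogeneousSubmodule _ _).2
      (MvPolynomial.isHomogeneous_X k s)), MvPolynomial.eval_X] at hmem
    exact hs hmem
  rw [← Ideal.unit_mul_mem_iff_mem _ (isUnit_algebraMap hXs)]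
  -- Subtracting x_s times the vanishing sum turns the coefficients into x_t X_s - x_s X_t, which
  -- are zero at [x].
  have h1 : algebraMap (CoordRing k n) (Loc k n (point x hx)) (MvPolynomial.X s) *
      φ (wedge (add_comm 1 q) (ofVec x) η) =
      ∑ t : Fin (n + 1), algebraMap (CoordRing k n) (Loc k n (point x hx))
        (x t • MvPolynomial.X s - x s • MvPolynomial.X t) *
          φ (wedge (add_comm 1 q) (ofVec (Pi.single t 1)) η) := by
    have h2 : x s • ∑ t : Fin (n + 1),
        algebraMap (CoordRing k n) (Loc k n (point x hx)) (MvPolynomial.X t) *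
          φ (wedge (add_comm 1 q) (ofVec (Pi.single t 1)) η) = 0 := by rw [h, smul_zero]
    rw [← sub_zero (_ * _), ← h2, wedge_ofVec_eq_sum, map_sum, Finset.mul_sum, Finset.smul_sum,
      ← Finset.sum_sub_distrib]
    refine Finset.sum_congr rfl fun t _ => ?_
    rw [map_sub, algebraMap_smul', algebraMap_smul', sub_mul]
    simp
  rw [h1]
  refine sum_mem fun t _ => Ideal.mul_mem_right _ _ ((algebraMap_mem_vanishing _).2 ?_)
  rw [mem_point_iff x hx (d := 1)]
  · simp [MvPolynomial.smul_eval, mul_comm]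
  · exact sub_mem (Submodule.smul_mem _ _ ((MvPolynomial.mem_homogeneousSubmodule _ _).2
      (MvPolynomial.isHomogeneous_X k s))) (Submodule.smul_mem _ _
        ((MvPolynomial.mem_homogeneousSubmodule _ _).2 (MvPolynomial.isHomogeneous_X k t)))

end point

/-! ### Linear forms on V as polynomials -/

section linForm

open Module

/-- The linear form of the coordinate ring given by a linear form on `V`. -/
def linForm (f : Dual k (Vec k n)) : CoordRing k n :=
  ∑ t, f (Pi.single t 1) • MvPolynomial.X t

lemma linForm_mem (f : Dual k (Vec k n)) : linForm f ∈ grading k n 1 :=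
  sum_mem fun t _ => Submodule.smul_mem _ _ ((MvPolynomial.mem_homogeneousSubmodule _ _).2
    (MvPolynomial.isHomogeneous_X k t))

lemma eval_linForm (f : Dual k (Vec k n)) (x : Vec k n) :
    MvPolynomial.eval x (linForm f) = f x := by
  conv_rhs => rw [pi_eq_sum_univ' x]
  simp [linForm, MvPolynomial.smul_eval, mul_comm]

lemma linForm_mem_outside_point {f : Dual k (Vec k n)} {x : Vec k n} (hx : x ≠ 0)
    (hf : f x ≠ 0) : linForm f ∈ outside (point x hx) := by
  intro h
  rw [SetLike.mem_coe, mem_point_iff x hx (linForm_mem f), eval_linForm] at h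
  exact hf h

/-- The open set where a polynomial does not vanish. -/
def nonvanishing (F : CoordRing k n) : (ProjSpace k n).Opens :=
  ProjectiveSpectrum.basicOpen (grading k n) F

/-- A linear form on `V` as a linear form on `⋀^1 V`. -/
def dualOne (g : Dual k (Vec k n)) : ⋀[k]^1 (Vec k n) →ₗ[k] k :=
  g ∘ₗ (exteriorPower.oneEquiv k (Vec k n)).toLinearMap

lemma dualOne_ofVec (g : Dual k (Vec k n)) (y : Vec k n) : dualOne g (ofVec y) = g y := by
  simp [dualOne, ofVec]

lemma interior_wedge_ofVec (f : Dual k (Vec k n)) (x y : Vec k n) :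
    interior f 1 (wedge (show 1 + 1 = 2 by rfl) (ofVec x) (ofVec y)) =
      f x • ofVec y - f y • ofVec x := by
  apply Subtype.ext
  rw [coe_interior, coe_wedge_ofVec, coe_ofVec, CliffordAlgebra.contractLeft_ι_mul]
  rw [AddSubgroupClass.coe_sub, Submodule.coe_smul, Submodule.coe_smul, coe_ofVec, coe_ofVec]
  rw [CliffordAlgebra.contractLeft_ι, Algebra.smul_def (f y), Algebra.commutes]

end linForm

/-! ### The obstruction to surjectivity of φ at a point of a bad plane -/

section plane

open Module

variable {l : ℤ} {U : (ProjSpace k n).Opens}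

/-- A multivector annihilated by x is a multiple of x, and sections of Ω^{q+1} vanish at [x] on such
multiples. -/
lemma value_omegaι_mem_vanishing [CharZero k] {x : Vec k n} (hx : x ≠ 0) {f : Dual k (Vec k n)}
    (hf : f x = 1) {q : ℕ} (s : Γ(Omega k n (q + 1) l, U)) (hp : point x hx ∈ U)
    (ζ : ⋀[k]^(q + 1) (Vec k n))
    (hζ : ExteriorAlgebra.ι k x * (ζ : ExteriorAlgebra k (Vec k n)) = 0) :
    value (omegaι s) (point x hx) hp ζ ∈ vanishing (point x hx) := by
  have h : ζ = wedge (add_comm 1 q) (ofVec x) (interior f q ζ) := by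
    apply Subtype.ext
    rw [coe_wedge_ofVec, coe_interior]
    exact eq_ι_mul_contractLeft hf hζ
  rw [h]
  exact wedge_mem_vanishing x hx _ _ (sum_value_omegaι s _ hp _)

lemma ι_mul_two_comm (u : Vec k n) (ω : ⋀[k]^2 (Vec k n)) :
    (ω : ExteriorAlgebra k (Vec k n)) * ExteriorAlgebra.ι k u = ExteriorAlgebra.ι k u * ω := by
  rw [ι_mul_comm u _ ω.2]
  simp

end plane

section phi

open Module

variable {ω : ⋀[k]^2 (Vec k 4)} {v : Vec k 4} {l : ℤ} {U : (ProjSpace k 4).Opens}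

lemma omegaι_phi (s : Γ(Omega k 4 3 l ⊞ Omega k 4 2 l, U)) :
    omegaι ((phi k ω v l).app U s) =
      (contractE (show 2 + 1 = 3 by rfl) ω l).app U
        (omegaι (Scheme.Modules.Hom.app (biprod.fst : Omega k 4 3 l ⊞ Omega k 4 2 l ⟶ _) U s)) +
      (contractE (show 1 + 1 = 2 by rfl) (ofVec v) l).app U
        (omegaι (Scheme.Modules.Hom.app (biprod.snd : Omega k 4 3 l ⊞ Omega k 4 2 l ⟶ _) U s)) := by
  rw [← omegaι_contract, ← omegaι_contract, phi, biprod_desc_app]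
  exact map_add _ _ _

/-- A plane that kills `ω` and `v` prevents `phi` from being surjective at its points. -/
lemma value_omegaι_phi_mem_vanishing [CharZero k] {x u : Vec k 4} (hx : x ≠ 0)
    {f : Dual k (Vec k 4)} (hf : f x = 1)
    (hω : ExteriorAlgebra.ι k x * (ExteriorAlgebra.ι k u * (ω : ExteriorAlgebra k (Vec k 4))) = 0)
    (hv : ExteriorAlgebra.ι k x * (ExteriorAlgebra.ι k u * ExteriorAlgebra.ι k v) = 0)
    (s : Γ(Omega k 4 3 l ⊞ Omega k 4 2 l, U)) (hp : point x hx ∈ U) :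
    value (omegaι ((phi k ω v l).app U s)) (point x hx) hp (ofVec u) ∈
      vanishing (point x hx) := by
  have h₁ := value_omegaι_mem_vanishing hx hf
    (Scheme.Modules.Hom.app (biprod.fst : Omega k 4 3 l ⊞ Omega k 4 2 l ⟶ _) U s) hp
    (wedge (show 2 + 1 = 3 by rfl) ω (ofVec u)) (by rw [coe_wedge, coe_ofVec, ι_mul_two_comm, hω])
  have h₂ := value_omegaι_mem_vanishing hx hf
    (Scheme.Modules.Hom.app (biprod.snd : Omega k 4 3 l ⊞ Omega k 4 2 l ⟶ _) U s) hp
    (wedge (show 1 + 1 = 2 by rfl) (ofVec v) (ofVec u)) (by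
      rw [coe_wedge_ofVec, coe_ofVec, mul_ι_anticomm u v, mul_neg, hv, neg_zero])
  rw [omegaι_phi]
  exact Ideal.add_mem _ h₁ h₂

/-- The section `(g ∘ (f ⌟ ·)) / F` of `𝒪(l - 1) ⊗ ⋀^2 V^∨`. -/
def planeSection (f g : Dual k (Vec k 4)) {e : ℕ} (hl : ((0 : ℕ) : ℤ) = e + (l - 1))
    (F : CoordRing k 4) (hF : F ∈ grading k 4 e)
    (hU : ∀ x : U, F ∈ outside (k := k) (n := 4) x.1) : Γ(E k 4 2 (l - 1), U) :=
  fracSection hl (Algebra.linearMap k (CoordRing k 4) ∘ₗ dualOne g ∘ₗ interior f 1)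
    (fun _ => (MvPolynomial.mem_homogeneousSubmodule _ _).2 (MvPolynomial.isHomogeneous_C _ _))
    F hF hU

/-- Since f(u) = 0 and g(u) = 1, the differential takes the value f/F on u, and f(x) = 1. This is
the section that φ misses when the plane of x and u kills ω and v. -/
lemma value_planeSection_notMem_vanishing {x u : Vec k 4} (hx : x ≠ 0) {f g : Dual k (Vec k 4)}
    (hf : f x = 1) (hfu : f u = 0) (hgu : g u = 1) {e : ℕ} (hl : ((0 : ℕ) : ℤ) = e + (l - 1))
    (F : CoordRing k 4) (hF : F ∈ grading k 4 e)
    (hU : ∀ x : U, F ∈ outside (k := k) (n := 4) x.1) (hp : point x hx ∈ U) :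
    value (omegaι (toOmega (planeSection f g hl F hF hU))) (point x hx) hp (ofVec u) ∉
      vanishing (point x hx) := by
  rw [omegaι_toOmega]
  refine fun hmem => ?_
  have h0 := (value_koszulD 1 (planeSection f g hl F hF hU) (point x hx) hp (ofVec u)).symm
  have h1 (t : Fin 5) : value (planeSection f g hl F hF hU) (point x hx) hp
      (wedge (add_comm 1 1) (ofVec (Pi.single t 1)) (ofVec u)) =
        Localization.mk (1 : CoordRing k 4) ⟨F, hU ⟨_, hp⟩⟩ *
          algebraMap (CoordRing k 4) (Loc k 4 (point x hx)) (algebraMap k _ (f (Pi.single t 1))) := by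
    refine (value_fracSection hl _ _ F hF hU _ hp _).trans ?_
    have h2 := interior_wedge_ofVec f (Pi.single t 1) u
    rw [hfu, zero_smul, sub_zero] at h2
    have h3 := congrArg (dualOne g) h2
    rw [map_smul, dualOne_ofVec, hgu, smul_eq_mul, mul_one] at h3
    rw [LinearMap.comp_apply, LinearMap.comp_apply]
    exact congrArg (fun z => Localization.mk (1 : CoordRing k 4) ⟨F, hU ⟨_, hp⟩⟩ *
      algebraMap (CoordRing k 4) (Loc k 4 (point x hx)) (algebraMap k _ z)) h3
  have h4 : ∑ t : Fin 5, algebraMap (CoordRing k 4) (Loc k 4 (point x hx)) (MvPolynomial.X t) *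
      (Localization.mk (1 : CoordRing k 4) ⟨F, hU ⟨_, hp⟩⟩ *
          algebraMap (CoordRing k 4) (Loc k 4 (point x hx))
            (algebraMap k _ (f (Pi.single t 1)))) =
      Localization.mk (1 : CoordRing k 4) ⟨F, hU ⟨_, hp⟩⟩ *
        algebraMap (CoordRing k 4) (Loc k 4 (point x hx)) (linForm f) := by
    rw [linForm, map_sum, Finset.mul_sum]
    refine Finset.sum_congr rfl fun t _ => ?_
    rw [Algebra.smul_def, map_mul]
    ring
  simp only [h1] at h0
  have h5 := (h4.symm.trans h0) ▸ hmem
  rw [Ideal.unit_mul_mem_iff_mem, algebraMap_mem_vanishing] at h5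
  · exact linForm_mem_outside_point hx (by rw [hf]; exact one_ne_zero) h5
  · refine IsUnit.of_mul_eq_one (algebraMap _ _ F) ?_
    rw [← Localization.mk_one_eq_algebraMap, Localization.mk_mul, one_mul, mul_one]
    exact Localization.mk_self (⟨F, hU ⟨_, hp⟩⟩ : outside (point x hx))

/-- `ω = v₀ ∧ v₁ + v₂ ∧ v₃` and `v = v₄` for a basis `v₀, …, v₄` of `V`. -/
def IsNormalForm (ω : ⋀[k]^2 (Vec k 4)) (v : Vec k 4) : Prop :=
  ∃ b : Basis (Fin 5) k (Fin 5 → k),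
    ω = exteriorPower.ιMulti k 2 ![b 0, b 1] + exteriorPower.ιMulti k 2 ![b 2, b 3] ∧ v = b 4

lemma isNormalForm_of_epi_phi [CharZero k] (h : Epi (phi k ω v 0)) : IsNormalForm ω v := by
  by_contra hc
  obtain ⟨x, u, f, g, hf, hfu, hgu, hω, hv⟩ := exists_plane_of_not_normal_form ω v hc
  have hx : x ≠ 0 := fun h0 => by simp [h0] at hf
  have hU : ∀ x : nonvanishing (linForm f), linForm f ∈ outside (k := k) (n := 4) x.1 :=
    fun x => x.2
  -- For l = 0 the form must have coefficients of degree -1, so it is divided by the linear form `f`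
  -- on the locus where `f` is nonzero.
  obtain ⟨V, i, t, hV, e⟩ := exists_local_preimage (phi k ω v 0)
    (toOmega (planeSection f g (l := 0) (e := 1) (by norm_num) _ (linForm_mem f) hU))
    (x := point x hx) (linForm_mem_outside_point hx (by rw [hf]; exact one_ne_zero))
  refine value_planeSection_notMem_vanishing hx hf hfu hgu (l := 0) (e := 1) (by norm_num) _
    (linForm_mem f) hU (i.le hV) ?_
  have h1 := value_omegaι_phi_mem_vanishing hx hf hω hv t hV
  rw [e, omegaι_map] at h1
  exact h1

lemma isNormalForm_of_surjective_phi [CharZero k]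
    (h : Function.Surjective (Scheme.Modules.Hom.app (phi k ω v 1) ⊤)) : IsNormalForm ω v := by
  by_contra hc
  obtain ⟨x, u, f, g, hf, hfu, hgu, hω, hv⟩ := exists_plane_of_not_normal_form ω v hc
  have hx : x ≠ 0 := fun h0 => by simp [h0] at hf
  have hU : ∀ x : (⊤ : (ProjSpace k 4).Opens), (1 : CoordRing k 4) ∈
      outside (k := k) (n := 4) x.1 := fun x => one_mem _
  -- For l = 1 the coefficients have degree 0, so the denominator is 1 and the section is global.
  obtain ⟨t, e⟩ := h (toOmega (planeSection f g (l := 1) (e := 0) (by norm_num) _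
    (SetLike.one_mem_graded (grading k 4)) hU))
  refine value_planeSection_notMem_vanishing hx hf hfu hgu (l := 1) (e := 0) (by norm_num) _
    (SetLike.one_mem_graded (grading k 4)) hU (Opens.mem_top _) ?_
  have h1 := value_omegaι_phi_mem_vanishing hx hf hω hv t (Opens.mem_top _)
  rw [e] at h1
  exact h1

end phi

/-! ### Lifting the Koszul epimorphism through φ -/

section lift

variable {ω : ⋀[k]^2 (Vec k 4)} {v : Vec k 4}

/-- An injective linear map splits. The minus sign matches the sign (-1)^p with which contraction by
a p-vector commutes with the Koszul differential, for p = 1. -/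
lemma exists_leftInverse_two (h : IsNormalForm ω v) :
    ∃ (g₄ : ⋀[k]^4 (Vec k 4) →ₗ[k] ⋀[k]^2 (Vec k 4))
      (g₃ : ⋀[k]^3 (Vec k 4) →ₗ[k] ⋀[k]^2 (Vec k 4)), ∀ η,
      g₄ (wedge (show 2 + 2 = 4 by rfl) ω η) -
        g₃ (wedge (show 1 + 2 = 3 by rfl) (ofVec v) η) = η := by
  obtain ⟨b, hω, hv⟩ := h
  obtain ⟨g, hg⟩ := LinearMap.exists_leftInverse_of_injective _
    (LinearMap.ker_eq_bot.2 (wedge_two_injective hω hv))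
  refine ⟨g ∘ₗ LinearMap.inl k _ _, -(g ∘ₗ LinearMap.inr k _ _), fun η => ?_⟩
  have h1 := LinearMap.congr_fun hg η
  simp only [LinearMap.comp_apply, LinearMap.neg_apply, sub_neg_eq_add, ← map_add,
    LinearMap.inl_apply, LinearMap.inr_apply, Prod.mk_add_mk, add_zero, zero_add]
  exact h1

/-- The morphism `𝒪(l) ⊗ ⋀^p V^∨ ⟶ 𝒪(l) ⊗ ⋀^q V^∨` induced by a linear map. -/
def precompE {p q : ℕ} (g : ⋀[k]^q (Vec k n) →ₗ[k] ⋀[k]^p (Vec k n)) (l : ℤ) :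
    E k n p l ⟶ E k n q l :=
  precomp l g

/-- In the normal form the Koszul differential `𝒪(l - 1) ⊗ ⋀^2 V^∨ ⟶ Ω^1(1 + l)` factors through
`phi`. -/
lemma exists_lift_phi (h : IsNormalForm ω v) (l : ℤ) :
    ∃ σ : E k 4 (1 + 1) (l - 1) ⟶ Omega k 4 3 l ⊞ Omega k 4 2 l,
      σ ≫ phi k ω v l = omegaπ k 4 1 l := by
  obtain ⟨g₄, g₃, hg⟩ := exists_leftInverse_two h
  refine ⟨biprod.lift (precompE (p := 1 + 1) (q := 3 + 1) g₄ (l - 1) ≫ omegaπ k 4 3 l)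
    (precompE (p := 1 + 1) (q := 2 + 1) g₃ (l - 1) ≫ omegaπ k 4 2 l), ?_⟩
  rw [phi, biprod.lift_desc, Category.assoc, Category.assoc, omegaπ_contract,
    omegaπ_contract, ← Category.assoc, ← Category.assoc, ← Preadditive.add_comp]
  conv_rhs => rw [← Category.id_comp (omegaπ k 4 1 l)]
  -- It remains to see that an endomorphism of 𝒪(l-1) ⊗ ⋀²V^∨ is the identity; it is the transpose
  -- of the left inverse identity `hg`.
  congr 1
  refine Scheme.Modules.hom_ext _ _ fun U => ?_
  ext s
  refine section_ext fun x hx η => ?_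
  change value s x hx (g₄ (wedge _ ((-1 : k) ^ 2 • ω) η)) +
    value s x hx (g₃ (wedge _ ((-1 : k) ^ 1 • ofVec v) η)) = value s x hx η
  rw [← map_add]
  congr 1
  refine Eq.trans ?_ (hg η)
  have h1 : wedge (show 2 + 2 = 4 by rfl) ((-1 : k) ^ 2 • ω) η =
      wedge (show 2 + 2 = 4 by rfl) ω η := by simp
  have h2 : wedge (show 1 + 2 = 3 by rfl) ((-1 : k) ^ 1 • ofVec v) η =
      - wedge (show 1 + 2 = 3 by rfl) (ofVec v) η := by
    apply Subtype.ext
    rw [coe_wedge, Submodule.coe_neg, coe_wedge, Submodule.coe_smul, pow_one, smul_mul_assoc,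
      neg_smul, one_smul]
  rw [sub_eq_add_neg, ← map_neg]
  exact congrArg₂ (· + ·) (congrArg g₄ h1) (congrArg g₃ h2)

lemma epi_phi_of_isNormalForm (h : IsNormalForm ω v) (l : ℤ) : Epi (phi k ω v l) := by
  obtain ⟨σ, hσ⟩ := exists_lift_phi h l
  exact epi_of_epi_fac hσ

end lift

/-! ### Global sections of 𝒪(1) and of Ω^{q+1}(q+2) -/

section globalSections

lemma exists_structure_section {U : Opens (ProjectiveSpectrum.top (grading k n))}
    {z : ∀ x : U, Loc k n x.1} (hz : (isLocallyFraction k n 0).pred z) :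
    ∃ r : (ProjectiveSpectrum.Proj.structureSheaf (grading k n)).1.obj (op U),
      ∀ x, (r.1 x).val = z x := by
  have h (x : U) : ∃ a : HomogeneousLocalization (grading k n) (outside x.1), a.val = z x := by
    obtain ⟨V, m, i, a, b, h, r, s, hr, hs, hn, e⟩ := hz x
    obtain rfl : a = b := by omega
    exact ⟨.mk ⟨a, ⟨r, hr⟩, ⟨s, hs⟩, hn ⟨x.1, m⟩⟩, (e ⟨x.1, m⟩).symm⟩
  choose a ha using h
  refine ⟨⟨a, fun x => ?_⟩, ha⟩
  obtain ⟨V, m, i, c, b, h, r, s, hr, hs, hn, e⟩ := hz x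
  obtain rfl : c = b := by omega
  refine ⟨V, m, i, c, ⟨r, hr⟩, ⟨s, hs⟩, hn, fun y => ?_⟩
  apply HomogeneousLocalization.val_injective
  exact (ha _).trans (e y)

/-- On `D(X_t)` a section of `𝒪(1)` is a fraction with a power of `X_t` as denominator. -/
lemma exists_fraction_of_X {z : ∀ x : (⊤ : Opens (ProjectiveSpectrum.top (grading k n))), Loc k n x.1}
    (hz : (isLocallyFraction k n 1).pred z) (t : Fin (n + 1)) :
    ∃ (m : ℕ) (N : CoordRing k n), N ∈ grading k n (m + 1) ∧
      ∀ (p : ProjectiveSpectrum (grading k n)), MvPolynomial.X t ∈ outside p →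
        z ⟨p, trivial⟩ * algebraMap (CoordRing k n) (Loc k n p) (MvPolynomial.X t ^ m) =
          algebraMap _ _ N := by
  have hX : (MvPolynomial.X t : CoordRing k n) ∈ grading k n 1 :=
    (MvPolynomial.mem_homogeneousSubmodule _ _).2 (MvPolynomial.isHomogeneous_X k t)
  let D : Opens (ProjectiveSpectrum.top (grading k n)) :=
    ProjectiveSpectrum.basicOpen (grading k n) (MvPolynomial.X t)
  -- Multiplication by 1/X_t makes the section one of the structure sheaf on D(X_t), whose sections
  -- are the degree 0 part of S[1/X_t].
  have h1 : (isLocallyFraction k n (-1)).pred (U := D) fun p =>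
      Localization.mk (1 : CoordRing k n) ⟨MvPolynomial.X t, p.2⟩ := fun p =>
    ⟨D, p.2, 𝟙 _, 0, 1, by norm_num, 1, MvPolynomial.X t, SetLike.one_mem_graded _, hX,
      fun y => y.2, fun y => rfl⟩
  obtain ⟨r, hr⟩ := exists_structure_section (locFrac_mul (show (-1 : ℤ) + 1 = 0 by norm_num) h1
    ((isLocallyFraction k n 1).res (homOfLE le_top : D ⟶ ⊤) z hz))
  have hs : Function.Surjective (Proj.awayToSection (grading k n) (MvPolynomial.X t)) := by
    have : IsIso (Proj.awayToSection (grading k n) (MvPolynomial.X t)) := by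
      rw [← Proj.basicOpenIsoAway_hom (grading k n) _ hX one_pos]
      infer_instance
    exact (ConcreteCategory.bijective_of_isIso _).2
  obtain ⟨a, ha⟩ := hs r
  obtain ⟨⟨d, N, D', m, hm⟩, rfl⟩ := HomogeneousLocalization.mk_surjective a
  have hm : (MvPolynomial.X t : CoordRing k n) ^ m = D'.1 := hm
  obtain rfl : d = m := by
    have h2 : (MvPolynomial.X t ^ m : CoordRing k n) ∈ grading k n m := by
      simpa using (MvPolynomial.isHomogeneous_X k t).pow m
    exact (hm ▸ D'.2 : (MvPolynomial.X t ^ m : CoordRing k n).IsHomogeneous d).inj_right h2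
      (pow_ne_zero _ (MvPolynomial.X_ne_zero t))
  refine ⟨d, N.1 * MvPolynomial.X t, SetLike.mul_mem_graded N.2 hX, fun p hp => ?_⟩
  have h3 := hr ⟨p, hp⟩
  rw [← ha] at h3
  have h4 := ProjectiveSpectrum.Proj.awayToSection_apply (grading k n) (MvPolynomial.X t)
    (HomogeneousLocalization.mk ⟨d, N, D', d, hm⟩) ⟨p, hp⟩
  have h5 := h4.symm.trans h3
  rw [HomogeneousLocalization.val_mk, Localization.mk_eq_mk', IsLocalization.map_mk',
    IsLocalization.mk'_eq_iff_eq_mul] at h5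
  have h6 : Localization.mk (1 : CoordRing k n) ⟨MvPolynomial.X t, hp⟩ *
      algebraMap (CoordRing k n) (Loc k n p) (MvPolynomial.X t) = 1 := by
    rw [← Localization.mk_one_eq_algebraMap, Localization.mk_mul, one_mul, mul_one]
    exact Localization.mk_self (⟨MvPolynomial.X t, hp⟩ : outside p)
  rw [map_mul, hm]
  refine Eq.trans ?_ (congrArg (· * algebraMap (CoordRing k n) (Loc k n p)
    (MvPolynomial.X t)) h5).symm
  calc z ⟨p, trivial⟩ * algebraMap (CoordRing k n) (Loc k n p) D'.1
      = (Localization.mk (1 : CoordRing k n) ⟨MvPolynomial.X t, hp⟩ *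
        algebraMap (CoordRing k n) (Loc k n p) (MvPolynomial.X t)) * (z ⟨p, trivial⟩ *
          algebraMap (CoordRing k n) (Loc k n p) D'.1) := by rw [h6, one_mul]
    _ = Localization.mk (1 : CoordRing k n) ⟨MvPolynomial.X t, hp⟩ * z ⟨p, trivial⟩ *
        algebraMap (CoordRing k n) (Loc k n p) D'.1 *
          algebraMap (CoordRing k n) (Loc k n p) (MvPolynomial.X t) := by ring

lemma algebraMap_loc_injective (p : ProjectiveSpectrum (grading k n)) :
    Function.Injective (algebraMap (CoordRing k n) (Loc k n p)) :=
  IsLocalization.injective (Loc k n p) (M := outside p) (Ideal.primeCompl_le_nonZeroDivisors _)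

/-- The global sections of `𝒪(1)` are the linear forms. -/
lemma exists_linear_of_section (hn : 0 < n)
    {z : ∀ x : (⊤ : Opens (ProjectiveSpectrum.top (grading k n))), Loc k n x.1}
    (hz : (isLocallyFraction k n 1).pred z) :
    ∃ q ∈ grading k n 1, ∀ p : ProjectiveSpectrum (grading k n),
      z ⟨p, trivial⟩ = algebraMap (CoordRing k n) (Loc k n p) q := by
  choose m N hN e using exists_fraction_of_X hz
  let P : ProjectiveSpectrum (grading k n) :=
    point 1 (fun h => one_ne_zero (congrFun h 0))
  have hP (t : Fin (n + 1)) : MvPolynomial.X t ∈ outside P := by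
    intro h
    rw [SetLike.mem_coe, mem_point_iff _ _ ((MvPolynomial.mem_homogeneousSubmodule _ _).2
      (MvPolynomial.isHomogeneous_X k t)), MvPolynomial.eval_X] at h
    exact one_ne_zero h
  have hc (s t : Fin (n + 1)) : N t * MvPolynomial.X s ^ m s = N s * MvPolynomial.X t ^ m t := by
    apply algebraMap_loc_injective P
    rw [map_mul, map_mul, ← e t P (hP t), ← e s P (hP s)]
    ring
  have hX (t : Fin (n + 1)) (d : ℕ) : (MvPolynomial.X t ^ d : CoordRing k n) ∈ grading k n d := by
    simpa using (MvPolynomial.isHomogeneous_X k t).pow d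
  obtain ⟨q, hq, hq1⟩ : ∃ q, N 0 = MvPolynomial.X 0 ^ m 0 * q ∧ q ∈ grading k n 1 := by
    -- X_0 is prime and does not divide X_n, a different variable because n > 0; so the denominator
    -- on D(X_0) cancels.
    have hdvd : (MvPolynomial.X 0 ^ m 0 : CoordRing k n) ∣ N 0 := by
      refine (MvPolynomial.X_prime (i := (0 : Fin (n + 1)))).pow_dvd_of_dvd_mul_right _
        (b := MvPolynomial.X (Fin.last n) ^ m (Fin.last n)) ?_
        (Dvd.intro_left _ (hc 0 (Fin.last n)))
      intro h
      have h2 := MvPolynomial.X_prime.dvd_of_dvd_pow h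
      rw [MvPolynomial.X_dvd_X] at h2
      exact hn.ne (congrArg Fin.val h2)
    obtain ⟨q, hq⟩ := hdvd
    -- Passing to the degree one component of the quotient avoids proving that the quotient is
    -- homogeneous.
    refine ⟨DirectSum.decompose (grading k n) q 1, ?_, SetLike.coe_mem _⟩
    rw [← DirectSum.coe_decompose_mul_add_of_left_mem (grading k n) (hX 0 (m 0)), ← hq,
      DirectSum.decompose_of_mem_same _ (hN 0)]
  have hNt (t : Fin (n + 1)) : N t = MvPolynomial.X t ^ m t * q := by
    have h := hc 0 t
    rw [hq] at h
    refine mul_right_cancel₀ (pow_ne_zero (m 0) (MvPolynomial.X_ne_zero (R := k) 0)) (h.trans ?_)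
    ring
  refine ⟨q, hq1, fun p => ?_⟩
  obtain ⟨t, ht⟩ := exists_X_mem_outside p
  have h := e t p ht
  rw [hNt, map_mul, mul_comm] at h
  exact (isUnit_algebraMap (Submonoid.pow_mem _ ht (m t))).mul_left_cancel h

/-- A homogeneous polynomial of degree one is a linear form. -/
lemma exists_linForm_eq {q : CoordRing k n} (hq : q ∈ grading k n 1) :
    q = ∑ t, MvPolynomial.coeff (Finsupp.single t 1) q • MvPolynomial.X t := by
  classical
  rw [grading, MvPolynomial.homogeneousSubmodule_one_eq_span_X] at hq
  induction hq using Submodule.span_induction with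
  | mem x hx =>
    obtain ⟨t, rfl⟩ := hx
    rw [Finset.sum_eq_single t]
    · simp
    · intro s _ hs
      rw [MvPolynomial.coeff_X, if_neg, zero_smul]
      exact fun h => hs (Finsupp.single_left_injective one_ne_zero h).symm
    · simp
  | zero => simp
  | add x y _ _ hx hy =>
    conv_lhs => rw [hx, hy]
    simp only [MvPolynomial.coeff_add, add_smul, Finset.sum_add_distrib]
  | smul a x _ hx =>
    conv_lhs => rw [hx]
    simp only [MvPolynomial.coeff_smul, Finset.smul_sum, smul_smul, smul_eq_mul]

/-- The global sections of `𝓗om_k(W, 𝒪(1))`. -/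
lemma exists_coefficients {W : Type u} [AddCommGroup W] [Module k W] (hn : 0 < n)
    (s : Γ(homSheaf (k := k) n W 1, ⊤)) :
    ∃ c : Fin (n + 1) → W →ₗ[k] k, ∀ p (hp : p ∈ (⊤ : (ProjSpace k n).Opens)) w,
      value s p hp w = algebraMap (CoordRing k n) (Loc k n p) (∑ t, c t w • MvPolynomial.X t) := by
  choose F hF hv using fun w => exists_linear_of_section hn (isLocallyFraction_value s w)
  let P : ProjectiveSpectrum (grading k n) :=
    point 1 (fun h => one_ne_zero (congrFun h 0))
  -- The chosen polynomials depend linearly on w because S embeds in its localization at a single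
  -- point.
  let G : W →ₗ[k] CoordRing k n :=
    { toFun := F
      map_add' := fun a b => algebraMap_loc_injective P (by
        rw [map_add, ← hv, ← hv, ← hv, map_add])
      map_smul' := fun a b => algebraMap_loc_injective P (by
        rw [algebraMap_smul', ← hv, ← hv, map_smul, RingHom.id_apply]) }
  refine ⟨fun t => MvPolynomial.lcoeff k (Finsupp.single t 1) ∘ₗ G, fun p hp w => ?_⟩
  refine (hv w p).trans (congrArg _ ?_)
  exact exists_linForm_eq (hF w)

section const

variable {W : Type u} [AddCommGroup W] [Module k W] {l : ℤ} {U V : (ProjSpace k n).Opens}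

/-- The section of `𝓗om_k(W, 𝒪) = 𝒪 ⊗ W^∨` given by a linear form on `W`. -/
def constSection (hl : 0 = l) (A : W →ₗ[k] k) : Γ(homSheaf (k := k) n W l, U) :=
  fracSection (d := 0) (e := 0) (by simpa using hl) (Algebra.linearMap k (CoordRing k n) ∘ₗ A)
    (fun _ => (MvPolynomial.mem_homogeneousSubmodule _ _).2 (MvPolynomial.isHomogeneous_C _ _)) 1
    (SetLike.one_mem_graded _) (fun _ => one_mem _)

lemma value_constSection (hl : 0 = l) (A : W →ₗ[k] k) (x) (hx : x ∈ U) (w : W) :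
    value (constSection (n := n) hl A) x hx w = algebraMap k (Loc k n x) (A w) := by
  refine (value_fracSection _ _ _ _ _ _ x hx w).trans ?_
  rw [show (⟨1, _⟩ : outside x) = 1 from rfl, Localization.mk_one, one_mul,
    IsScalarTower.algebraMap_apply k (CoordRing k n) (Loc k n x)]
  rfl

/-- The section of `𝒪 ⊗ ⋀^i V^∨` given by a linear form on `⋀^i V`. -/
def constForm {i : ℕ} (hl : 0 = l) (A : ⋀[k]^i (Vec k n) →ₗ[k] k) : Γ(E k n i l, U) :=
  constSection hl A

lemma value_constForm {i : ℕ} (hl : 0 = l) (A : ⋀[k]^i (Vec k n) →ₗ[k] k) (x) (hx : x ∈ U)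
    (η : ⋀[k]^i (Vec k n)) :
    value (constForm hl A) x hx η = algebraMap k (Loc k n x) (A η) :=
  value_constSection hl A x hx η

end const

variable {q : ℕ}

/-- The global sections of `Ω^{q+1}(q + 2)` are the Koszul differentials of the forms on
`⋀^{q+2} V`. -/
lemma exists_toOmega_constForm_eq [CharZero k] (hn : 0 < n) (s : Γ(Omega k n (q + 1) 1, ⊤)) :
    ∃ A : ⋀[k]^(q + 1 + 1) (Vec k n) →ₗ[k] k, toOmega (constForm (by norm_num) A) = s := by
  obtain ⟨c, hc⟩ := exists_coefficients hn (W := ⋀[k]^(q + 1) (Vec k n)) (omegaι s)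
  let e (t : Fin (n + 1)) {p : ℕ} (η : ⋀[k]^p (Vec k n)) : ⋀[k]^(p + 1) (Vec k n) :=
    wedge (add_comm 1 p) (ofVec (Pi.single t 1)) η
  -- The cycle condition says that the quadratic form Σ c_s(e_t∧ζ) X_s X_t is zero; polarization at
  -- e_a, e_b, e_a + e_b gives antisymmetry.
  have hanti (a b : Fin (n + 1)) (ζ : ⋀[k]^q (Vec k n)) : c a (e b ζ) = - c b (e a ζ) := by
    let P : ProjectiveSpectrum (grading k n) := point 1 (fun h => one_ne_zero (congrFun h 0))
    have h0 : ∑ t, MvPolynomial.X t * ∑ s, c s (e t ζ) • MvPolynomial.X s = (0 : CoordRing k n) := by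
      apply algebraMap_loc_injective P
      rw [map_zero, ← sum_value_omegaι s P trivial ζ, map_sum]
      refine Finset.sum_congr rfl fun t _ => ?_
      rw [map_mul]
      exact congrArg _ (hc _ _ _).symm
    have h1 (x : Vec k n) : ∑ t, x t * ∑ s, c s (e t ζ) * x s = 0 := by
      have h := congrArg (MvPolynomial.eval x) h0
      simpa [MvPolynomial.smul_eval] using h
    have h2 := h1 (Pi.single a 1)
    have h3 := h1 (Pi.single b 1)
    have h4 := h1 (Pi.single a 1 + Pi.single b 1)
    simp only [Pi.add_apply, Pi.single_apply, mul_add, add_mul, Finset.sum_add_distrib, mul_ite,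
      ite_mul, mul_one, one_mul, mul_zero, zero_mul, Finset.sum_ite_eq', Finset.mem_univ,
      if_true] at h2 h3 h4
    linear_combination h4 - h2 - h3
  -- The candidate primitive up to a scalar: the Leibniz rule contributes c_s once, and antisymmetry
  -- with Euler's identity q + 1 more times, whence the division by q + 2.
  let B : ⋀[k]^(q + 1 + 1) (Vec k n) →ₗ[k] k :=
    ∑ t, c t ∘ₗ interior (LinearMap.proj t) (q + 1)
  have hB (s : Fin (n + 1)) (η : ⋀[k]^(q + 1) (Vec k n)) : B (e s η) = ((q + 2 : ℕ) : k) * c s η := by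
    have h1 (t : Fin (n + 1)) : c t (interior (LinearMap.proj t) (q + 1) (e s η)) =
        (Pi.single s 1 : Vec k n) t * c t η +
          c s (e t (interior (LinearMap.proj t) q η)) := by
      have h := interior_wedge (LinearMap.proj t) (Pi.single s 1) q η
      rw [h, map_sub, map_smul, sub_eq_add_neg]
      exact congrArg _ (by rw [hanti s t])
    have h2 := congrArg (c s) (sum_wedge_interior q η)
    rw [map_sum, map_smul] at h2
    simp only [B, LinearMap.sum_apply, LinearMap.comp_apply, h1, Finset.sum_add_distrib]
    refine (congrArg (_ + ·) h2).trans ?_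
    simp only [Pi.single_apply, ite_mul, one_mul, zero_mul, Finset.sum_ite_eq', Finset.mem_univ,
      if_true, smul_eq_mul]
    push_cast
    ring
  have hq : ((q + 2 : ℕ) : k) ≠ 0 := Nat.cast_ne_zero.2 (by omega)
  refine ⟨((q + 2 : ℕ) : k)⁻¹ • B, omegaι_injective ?_⟩
  rw [omegaι_toOmega]
  refine section_ext fun p hp η => ?_
  refine (value_koszulD _ _ p hp η).trans (Eq.trans ?_ (hc p hp η).symm)
  rw [map_sum]
  refine Finset.sum_congr rfl fun t _ => ?_
  have h := value_constForm (n := n) (U := ⊤) (show (0 : ℤ) = 1 - 1 by norm_num)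
    (((q + 2 : ℕ) : k)⁻¹ • B) p hp (e t η)
  refine (congrArg (_ * ·) h).trans ?_
  rw [LinearMap.smul_apply, hB, smul_eq_mul, inv_mul_cancel_left₀ hq]
  exact (mul_comm _ _).trans ((Algebra.smul_def _ _).symm.trans (algebraMap_smul' p _ _).symm)

end globalSections

section phi

variable {ω : ⋀[k]^2 (Vec k 4)} {v : Vec k 4}

/-- Every global section of Ω^1(2) comes from a global constant form, and the lift of the Koszul
epimorphism maps that form to a global preimage under φ(1). -/
lemma surjective_phi_of_isNormalForm [CharZero k] (h : IsNormalForm ω v) :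
    Function.Surjective (Scheme.Modules.Hom.app (phi k ω v 1) ⊤) := by
  intro s
  obtain ⟨σ, hσ⟩ := exists_lift_phi h 1
  obtain ⟨A, hA⟩ := exists_toOmega_constForm_eq (q := 0) (by norm_num) s
  refine ⟨σ.app ⊤ (constForm (by norm_num) A), Eq.trans ?_ hA⟩
  exact congrArg (fun φ => Scheme.Modules.Hom.app φ ⊤ _) hσ

end phi

/-! ### Values of ε on sections -/

section biprod

variable {X : Scheme.{u}} {A B : X.Modules} {U : X.Opens}

lemma exists_biprod_section (a : Γ(A, U)) (b : Γ(B, U)) :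
    ∃ s, Scheme.Modules.Hom.app (biprod.fst : A ⊞ B ⟶ A) U s = a ∧
      Scheme.Modules.Hom.app (biprod.snd : A ⊞ B ⟶ B) U s = b := by
  have h (C : X.Modules) (f : A ⊞ B ⟶ C) :
      f.app U (Scheme.Modules.Hom.app (biprod.inl : A ⟶ A ⊞ B) U a +
        Scheme.Modules.Hom.app (biprod.inr : B ⟶ A ⊞ B) U b) =
      (biprod.inl ≫ f).app U a + (biprod.inr ≫ f).app U b := map_add _ _ _
  refine ⟨_, (h _ biprod.fst).trans ?_, (h _ biprod.snd).trans ?_⟩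
  · rw [biprod.inl_fst, biprod.inr_fst]
    exact add_zero a
  · rw [biprod.inl_snd, biprod.inr_snd]
    exact zero_add b

end biprod

section contractO

variable {l : ℤ} {U : (ProjSpace k n).Opens}

/-- The value of a section of `𝒪(l)` at a point. -/
def valueO (s : Γ(O k n l, U)) (x : ProjectiveSpectrum (grading k n)) (hx : x ∈ U) : Loc k n x :=
  value (l := l) s x hx (1 : k)

lemma valueO_ext {s t : Γ(O k n l, U)} (h : ∀ x hx, valueO s x hx = valueO t x hx) : s = t :=
  section_ext (W := k) (l := l) fun x hx c => by
    have h1 : c = c • (1 : k) := (mul_one c).symm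
    rw [h1, map_smul, map_smul]
    exact congrArg (c • ·) (h x hx)

lemma valueO_contractO {p : ℕ} (ω : ⋀[k]^p (Vec k n)) (s : Γ(Omega k n p l, U)) (x) (hx : x ∈ U) :
    valueO ((contractO ω l).app U s) x hx = value (omegaι s) x hx ω :=
  (map_smul (value (omegaι s) x hx) (1 : k) ω).trans (one_smul k _)

end contractO

section epsilon

open Module

variable {ω : ⋀[k]^2 (Vec k 4)} {v : Vec k 4} {l : ℤ} {U : (ProjSpace k 4).Opens}

lemma valueO_epsilon (s : Γ(Omega k 4 2 l ⊞ Omega k 4 1 l, U))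
    (p : ProjectiveSpectrum (grading k 4)) (hp : p ∈ U) :
    valueO ((epsilon k ω v l).app U s) p hp =
      value (omegaι (Scheme.Modules.Hom.app
        (biprod.fst : Omega k 4 2 l ⊞ Omega k 4 1 l ⟶ _) U s)) p hp ω +
      value (omegaι (Scheme.Modules.Hom.app
        (biprod.snd : Omega k 4 2 l ⊞ Omega k 4 1 l ⟶ _) U s)) p hp (ofVec v) := by
  rw [epsilon, biprod_desc_app]
  exact congrArg₂ (· + ·) (valueO_contractO ω _ p hp) (valueO_contractO (ofVec v) _ p hp)

/-- If y were nonzero, ω and v would be multiples of y, so everything in the image of ε would vanish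
at [y], whereas the section 1 of 𝒪 does not. -/
lemma eq_zero_of_epi_epsilon [CharZero k] (h : Epi (epsilon k ω v 0)) {y : Vec k 4}
    (hω : ExteriorAlgebra.ι k y * (ω : ExteriorAlgebra k (Vec k 4)) = 0)
    (hv : ExteriorAlgebra.ι k y * ExteriorAlgebra.ι k v = 0) : y = 0 := by
  by_contra hy
  obtain ⟨f, hf⟩ := Projective.exists_dual_eq_one k hy
  let one : Γ(O k 4 0, ⊤) := constSection (W := k) rfl LinearMap.id
  have hone (p) (hp) : valueO one p hp = algebraMap (CoordRing k 4) _ 1 :=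
    (value_constSection (W := k) rfl LinearMap.id p hp 1).trans
      ((map_one _).trans (map_one _).symm)
  obtain ⟨V, i, t, hV, e⟩ := exists_local_preimage (epsilon k ω v 0) one (x := point y hy) trivial
  have h2 : valueO one (point y hy) (Opens.mem_top _) ∈ vanishing (point y hy) := by
    have h3 := Ideal.add_mem _
      (value_omegaι_mem_vanishing hy hf (Scheme.Modules.Hom.app
        (biprod.fst : Omega k 4 2 0 ⊞ Omega k 4 1 0 ⟶ _) V t) hV ω hω)
      (value_omegaι_mem_vanishing hy hf (Scheme.Modules.Hom.app
        (biprod.snd : Omega k 4 2 0 ⊞ Omega k 4 1 0 ⟶ _) V t) hV (ofVec v) (by rw [coe_ofVec, hv]))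
    have h4 := valueO_epsilon (ω := ω) (v := v) t (point y hy) hV
    rw [e] at h4
    exact h4.symm ▸ h3
  rw [hone _ (Opens.mem_top _), algebraMap_mem_vanishing] at h2
  exact (Ideal.ne_top_iff_one _).1 (point y hy).isPrime.ne_top h2

end epsilon

/-! ### Vanishing at a point and global generation -/

section vanish

variable {l : ℤ} {M : (ProjSpace k n).Modules}

/-- The sections whose image in `𝒪(l)` vanishes at a point. -/
def vanishingSubmodule (f : M ⟶ O k n l) (p : ProjectiveSpectrum (grading k n)) :
    PresheafOfModules.Submodule M.val where
  obj U :=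
    { carrier := {s : Γ(M, U.unop) |
        ∀ (hp : p ∈ U.unop), valueO (f.app U.unop s) p hp ∈ vanishing p}
      zero_mem' := fun hp => by
        have h := map_zero (f.app U.unop).hom
        exact (congrArg (fun z => valueO z p hp) h) ▸ Ideal.zero_mem _
      add_mem' := fun {a b} ha hb hp => by
        have h := map_add (f.app U.unop).hom a b
        exact (congrArg (fun z => valueO z p hp) h) ▸ Ideal.add_mem _ (ha hp) (hb hp)
      smul_mem' := fun r a ha hp => by
        have h := Scheme.Modules.Hom.app_smul f r a
        exact (congrArg (fun z => valueO z p hp) h) ▸ Ideal.mul_mem_left _ _ (ha hp) }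
  map {U V} g s hs hp := by
    have h := map_app f g.unop s
    exact (congrArg (fun z => valueO z p hp) h) ▸ hs (g.unop.le hp)

lemma isLocalSubmodule_vanishingSubmodule (f : M ⟶ O k n l)
    (p : ProjectiveSpectrum (grading k n)) : IsLocalSubmodule (vanishingSubmodule f p) := by
  intro U s h hp
  obtain ⟨V, i, hV, h'⟩ := h p hp
  have h1 := map_app f i s
  exact (congrArg (fun z => valueO z p hV) h1.symm) ▸ h' hV

/-- If all global sections of a globally generated sheaf vanish at a point under a morphism, so do
all sections. -/
lemma valueO_mem_vanishing_of_globallyGenerated (h : GloballyGenerated M)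
    (f : M ⟶ O k n l) (p : ProjectiveSpectrum (grading k n))
    (hg : ∀ (s : Γ(M, ⊤)) hp, valueO (f.app ⊤ s) p hp ∈ vanishing p) {U}
    (s : Γ(M, U)) (hp : p ∈ U) : valueO (f.app U s) p hp ∈ vanishing p :=
  mem_of_globallyGenerated h _ (isLocalSubmodule_vanishingSubmodule f p) hg s hp

end vanish

/-! ### Differentials of constant forms and of their combinations -/

section forms

open Module

variable {l : ℤ} {U : (ProjSpace k n).Opens} {q : ℕ}

/-- The linear form `y ↦ A (y ∧ η)`. -/
def wedgeDual (A : ⋀[k]^(q + 1) (Vec k n) →ₗ[k] k) (η : ⋀[k]^q (Vec k n)) : Dual k (Vec k n) where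
  toFun y := A (wedge (add_comm 1 q) (ofVec y) η)
  map_add' a b := by
    rw [← map_add]
    congr 1
    apply Subtype.ext
    rw [Submodule.coe_add]
    simp only [coe_wedge_ofVec, map_add, add_mul]
  map_smul' c a := by
    rw [RingHom.id_apply, ← map_smul]
    congr 1
    apply Subtype.ext
    rw [Submodule.coe_smul]
    simp only [coe_wedge_ofVec, map_smul, smul_mul_assoc]

lemma wedgeDual_apply (A : ⋀[k]^(q + 1) (Vec k n) →ₗ[k] k) (η : ⋀[k]^q (Vec k n)) (y : Vec k n) :
    wedgeDual A η y = A (wedge (add_comm 1 q) (ofVec y) η) := rfl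

lemma linForm_add (f g : Dual k (Vec k n)) : linForm (f + g) = linForm f + linForm g := by
  simp only [linForm, LinearMap.add_apply, add_smul, Finset.sum_add_distrib]

lemma value_koszulD_constForm (hl : 0 = l - 1) (A : ⋀[k]^(q + 1) (Vec k n) →ₗ[k] k)
    (p : ProjectiveSpectrum (grading k n)) (hp : p ∈ U) (η : ⋀[k]^q (Vec k n)) :
    value ((koszulD q l).app U (constForm hl A)) p hp η =
      algebraMap (CoordRing k n) (Loc k n p) (linForm (wedgeDual A η)) := by
  refine (value_koszulD _ _ p hp η).trans ?_
  rw [linForm, map_sum]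
  refine Finset.sum_congr rfl fun t _ => ?_
  refine (congrArg (_ * ·) (value_constForm hl A p hp _)).trans ?_
  rw [algebraMap_smul', Algebra.smul_def, mul_comm, wedgeDual_apply]

/-- The section `(A h - B g) / F` of `𝒪 ⊗ ⋀^i V^∨`, for linear forms `g`, `h`, `F` of the coordinate
ring. -/
def combination {i : ℕ} (hl : 0 = l) (A B : ⋀[k]^i (Vec k n) →ₗ[k] k) (f g h : Dual k (Vec k n))
    (hU : ∀ x : U, linForm f ∈ outside (k := k) (n := n) x.1) : Γ(E k n i l, U) :=
  fracSection (d := 1) (e := 1) (by omega)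
    (A.smulRight (linForm h) - B.smulRight (linForm g))
    (fun _ => sub_mem (Submodule.smul_mem _ _ (linForm_mem h))
      (Submodule.smul_mem _ _ (linForm_mem g))) (linForm f) (linForm_mem f) hU

lemma value_koszulD_combination (hl : 0 = l - 1) (A B : ⋀[k]^(q + 1) (Vec k n) →ₗ[k] k)
    (f g h : Dual k (Vec k n)) (hU : ∀ x : U, linForm f ∈ outside (k := k) (n := n) x.1)
    (p : ProjectiveSpectrum (grading k n)) (hp : p ∈ U) (η : ⋀[k]^q (Vec k n)) :
    value ((koszulD q l).app U (combination hl A B f g h hU)) p hp η =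
      Localization.mk (1 : CoordRing k n) ⟨linForm f, hU ⟨p, hp⟩⟩ *
        algebraMap (CoordRing k n) (Loc k n p)
          (linForm h * linForm (wedgeDual A η) - linForm g * linForm (wedgeDual B η)) := by
  refine (value_koszulD _ _ p hp η).trans ?_
  have h1 (f : Dual k (Vec k n)) : linForm f = ∑ t, f (Pi.single t 1) • MvPolynomial.X t := rfl
  rw [h1 (wedgeDual A η), h1 (wedgeDual B η), Finset.mul_sum, Finset.mul_sum,
    ← Finset.sum_sub_distrib, map_sum, Finset.mul_sum]
  refine Finset.sum_congr rfl fun t _ => ?_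
  refine (congrArg (_ * ·) (value_fracSection _ _ _ _ _ _ p hp _)).trans ?_
  rw [mul_left_comm, ← map_mul]
  refine congrArg (fun z => _ * algebraMap (CoordRing k n) (Loc k n p) z) ?_
  change MvPolynomial.X t * (wedgeDual A η (Pi.single t 1) • linForm h -
    wedgeDual B η (Pi.single t 1) • linForm g) = _
  simp only [Algebra.smul_def]
  ring

end forms

/-! ### Global generation of the kernel forces the normal form -/

section generated

open Module

variable {ω : ⋀[k]^2 (Vec k 4)} {v : Vec k 4}

/-- A global section of the kernel is a pair of constant forms (A, B) with A(y∧ω) + B(y∧v) = 0 for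
all y. At [x] its contraction with (η, w) is A(x∧η) + B(x∧w), which is this expression at y = u. -/
lemma valueO_epsilon_kernel_mem_vanishing [CharZero k] {x u w : Vec k 4} (hx : x ≠ 0)
    {η : ⋀[k]^2 (Vec k 4)}
    (hη : wedge (show 1 + 2 = 3 by rfl) (ofVec x) η = wedge (show 1 + 2 = 3 by rfl) (ofVec u) ω)
    (hw : wedge (show 1 + 1 = 2 by rfl) (ofVec x) (ofVec w) =
      wedge (show 1 + 1 = 2 by rfl) (ofVec u) (ofVec v))
    (s : Γ(kernel (epsilon k ω v 1), ⊤)) (hp : point x hx ∈ (⊤ : (ProjSpace k 4).Opens)) :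
    valueO ((kernel.ι (epsilon k ω v 1) ≫ epsilon k η w 1).app ⊤ s) (point x hx) hp ∈
      vanishing (point x hx) := by
  obtain ⟨A, hA⟩ := exists_toOmega_constForm_eq (q := 1) (by norm_num) (Scheme.Modules.Hom.app
    (biprod.fst : Omega k 4 2 1 ⊞ Omega k 4 1 1 ⟶ _) ⊤ ((kernel.ι (epsilon k ω v 1)).app ⊤ s))
  obtain ⟨B, hB⟩ := exists_toOmega_constForm_eq (q := 0) (by norm_num) (Scheme.Modules.Hom.app
    (biprod.snd : Omega k 4 2 1 ⊞ Omega k 4 1 1 ⟶ _) ⊤ ((kernel.ι (epsilon k ω v 1)).app ⊤ s))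
  have h (ω' : ⋀[k]^2 (Vec k 4)) (v' : Vec k 4) :
      valueO ((epsilon k ω' v' 1).app ⊤ ((kernel.ι (epsilon k ω v 1)).app ⊤ s)) (point x hx) hp =
        algebraMap (CoordRing k 4) (Loc k 4 (point x hx))
          (linForm (wedgeDual A ω' + wedgeDual B (ofVec v'))) := by
    rw [valueO_epsilon, ← hA, ← hB, omegaι_toOmega, omegaι_toOmega, linForm_add, map_add]
    refine congrArg₂ (· + ·) ?_ ?_
    · exact value_koszulD_constForm _ A _ hp ω'
    · exact value_koszulD_constForm _ B _ hp (ofVec v')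
  have h0 : linForm (wedgeDual A ω + wedgeDual B (ofVec v)) = 0 := by
    apply algebraMap_loc_injective (point x hx)
    rw [map_zero, ← h, app_kernel_ι]
    rfl
  have h1 : linForm (wedgeDual A η + wedgeDual B (ofVec w)) ∈
      (point x hx).asHomogeneousIdeal.toIdeal := by
    rw [mem_point_iff x hx (linForm_mem _), eval_linForm, LinearMap.add_apply, wedgeDual_apply,
      wedgeDual_apply, hη, hw]
    have h2 := congrArg (MvPolynomial.eval u) h0
    rwa [eval_linForm, map_zero] at h2
  exact (h η w).symm ▸ (algebraMap_mem_vanishing _).2 h1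

/-- The linear form `y ↦ A (y ∧ ω) + B (y ∧ v)`. -/
def pairing (ω : ⋀[k]^2 (Vec k 4)) (v : Vec k 4) (A : ⋀[k]^3 (Vec k 4) →ₗ[k] k)
    (B : ⋀[k]^2 (Vec k 4) →ₗ[k] k) : Dual k (Vec k 4) :=
  wedgeDual (q := 2) A ω + wedgeDual (q := 1) B (ofVec v)

/-- Let g and h be the linear forms to which ε(1) sends the differentials of (A, B) and (A', B').
The differential of (h(A, B) - g(A', B'))/f is a local section of the kernel, and its contraction
with (η, w) has numerator h(x)g(u) - g(x)h(u) at [x]. As global sections contract to zero there, so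
does this one. -/
lemma pairing_mul_comm [CharZero k] (hgg : GloballyGenerated (kernel (epsilon k ω v 1)))
    {x u w : Vec k 4} (hx : x ≠ 0) {η : ⋀[k]^2 (Vec k 4)}
    (hη : wedge (show 1 + 2 = 3 by rfl) (ofVec x) η = wedge (show 1 + 2 = 3 by rfl) (ofVec u) ω)
    (hw : wedge (show 1 + 1 = 2 by rfl) (ofVec x) (ofVec w) =
      wedge (show 1 + 1 = 2 by rfl) (ofVec u) (ofVec v))
    (A A' : ⋀[k]^3 (Vec k 4) →ₗ[k] k) (B B' : ⋀[k]^2 (Vec k 4) →ₗ[k] k) :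
    pairing ω v A' B' x * pairing ω v A B u = pairing ω v A B x * pairing ω v A' B' u := by
  obtain ⟨f, hf⟩ := Projective.exists_dual_eq_one k hx
  have hU : ∀ x : nonvanishing (linForm f), linForm f ∈ outside (k := k) (n := 4) x.1 :=
    fun x => x.2
  have hp : point x hx ∈ nonvanishing (linForm f) :=
    linForm_mem_outside_point hx (by rw [hf]; exact one_ne_zero)
  let g := pairing ω v A B
  let h := pairing ω v A' B'
  let α : Γ(Omega k 4 2 1, nonvanishing (linForm f)) :=
    toOmega (combination (i := 2 + 1) (by norm_num) A A' f g h hU)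
  let β : Γ(Omega k 4 1 1, nonvanishing (linForm f)) :=
    toOmega (combination (i := 1 + 1) (by norm_num) B B' f g h hU)
  obtain ⟨s, hs₁, hs₂⟩ := exists_biprod_section α β
  have hv (ω' : ⋀[k]^2 (Vec k 4)) (v' : Vec k 4) (p : ProjectiveSpectrum (grading k 4))
      (hp : p ∈ nonvanishing (linForm f)) :
      valueO ((epsilon k ω' v' 1).app _ s) p hp =
        Localization.mk (1 : CoordRing k 4) ⟨linForm f, hp⟩ *
          algebraMap (CoordRing k 4) (Loc k 4 p)
            (linForm h * linForm (pairing ω' v' A B) - linForm g * linForm (pairing ω' v' A' B')) := by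
    rw [valueO_epsilon, hs₁, hs₂, omegaι_toOmega, omegaι_toOmega]
    refine (congrArg₂ (· + ·) (value_koszulD_combination (q := 2) (by norm_num) A A' f g h hU p hp ω')
      (value_koszulD_combination (q := 1) (by norm_num) B B' f g h hU p hp (ofVec v'))).trans ?_
    rw [← mul_add, ← map_add]
    refine congrArg (fun z => _ * algebraMap (CoordRing k 4) (Loc k 4 p) z) ?_
    rw [pairing, pairing, linForm_add, linForm_add]
    ring
  obtain ⟨t, ht⟩ := exists_kernel_section (epsilon k ω v 1) s (valueO_ext fun p hp => by
    rw [hv ω v p hp, mul_comm (linForm h), sub_self, map_zero, mul_zero]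
    rfl)
  have h1 := valueO_mem_vanishing_of_globallyGenerated hgg
    (kernel.ι (epsilon k ω v 1) ≫ epsilon k η w 1) (point x hx)
    (fun s hp => valueO_epsilon_kernel_mem_vanishing hx hη hw s hp) t hp
  have h2 : valueO ((epsilon k η w 1).app _ ((kernel.ι (epsilon k ω v 1)).app _ t)) (point x hx) hp ∈
    vanishing (point x hx) := h1
  rw [ht, hv, Ideal.unit_mul_mem_iff_mem, algebraMap_mem_vanishing, mem_point_iff x hx (d := 2)] at h2
  · rw [map_sub, map_mul, map_mul] at h2
    simp only [eval_linForm] at h2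
    have h3 (A : ⋀[k]^3 (Vec k 4) →ₗ[k] k) (B : ⋀[k]^2 (Vec k 4) →ₗ[k] k) :
        pairing η w A B x = pairing ω v A B u :=
      congrArg₂ (· + ·) (congrArg A hη) (congrArg B hw)
    rw [h3, h3] at h2
    exact sub_eq_zero.1 h2
  · exact sub_mem (SetLike.mul_mem_graded (linForm_mem _) (linForm_mem _))
      (SetLike.mul_mem_graded (linForm_mem _) (linForm_mem _))
  · refine IsUnit.of_mul_eq_one (algebraMap _ _ (linForm f)) ?_
    rw [← Localization.mk_one_eq_algebraMap, Localization.mk_mul, one_mul, mul_one]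
    exact Localization.mk_self (⟨linForm f, hp⟩ : outside (point x hx))

/-- All 2×2 minors of the pair T x, T u vanish, where T y = (y∧ω, y∧v). As T is injective, x and u
are dependent, against f(x) = 1, f(u) = 0, g(u) = 1. -/
lemma isNormalForm_of_globallyGenerated [CharZero k] (heps : Epi (epsilon k ω v 0))
    (hgg : GloballyGenerated (kernel (epsilon k ω v 1))) : IsNormalForm ω v := by
  by_contra hc
  obtain ⟨x, u, f, g, hf, hfu, hgu, hω, hv⟩ := exists_plane_of_not_normal_form ω v hc
  have hx : x ≠ 0 := fun h0 => by simp [h0] at hf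
  have hη : wedge (show 1 + 2 = 3 by rfl) (ofVec x)
      (interior f 2 (wedge (show 1 + 2 = 3 by rfl) (ofVec u) ω)) =
        wedge (show 1 + 2 = 3 by rfl) (ofVec u) ω := by
    apply Subtype.ext
    rw [coe_wedge_ofVec, coe_interior, coe_wedge_ofVec]
    exact (eq_ι_mul_contractLeft hf hω).symm
  -- The contraction of u∧v by f is f(u)v - f(v)u, and f(u) = 0.
  have hw : wedge (show 1 + 1 = 2 by rfl) (ofVec x) (ofVec (-f v • u)) =
      wedge (show 1 + 1 = 2 by rfl) (ofVec u) (ofVec v) := by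
    apply Subtype.ext
    rw [coe_wedge_ofVec, coe_wedge_ofVec, coe_ofVec, coe_ofVec, eq_ι_mul_contractLeft hf hv,
      CliffordAlgebra.contractLeft_ι_mul, hfu, CliffordAlgebra.contractLeft_ι, ← Algebra.commutes,
      ← Algebra.smul_def, zero_smul, zero_sub, neg_smul, map_neg, map_smul]
  let T (y : Vec k 4) : ⋀[k]^3 (Vec k 4) × ⋀[k]^2 (Vec k 4) :=
    (wedge (show 1 + 2 = 3 by rfl) (ofVec y) ω, wedge (show 1 + 1 = 2 by rfl) (ofVec y) (ofVec v))
  have hT {y : Vec k 4} (h : T y = 0) : y = 0 := by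
    refine eq_zero_of_epi_epsilon heps (ω := ω) (v := v) ?_ ?_
    · have h1 := congrArg (fun z => (z.1 : ExteriorAlgebra k (Vec k 4))) h
      exact (coe_wedge_ofVec _ y ω).symm.trans h1
    · have h1 := congrArg (fun z => (z.2 : ExteriorAlgebra k (Vec k 4))) h
      rw [← coe_ofVec v]
      exact (coe_wedge_ofVec _ y (ofVec v)).symm.trans h1
  have hp (D : Dual k (⋀[k]^3 (Vec k 4) × ⋀[k]^2 (Vec k 4))) (y : Vec k 4) :
      pairing ω v (D ∘ₗ LinearMap.inl k _ _) (D ∘ₗ LinearMap.inr k _ _) y = D (T y) := by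
    have h1 : T y = LinearMap.inl k _ _ (T y).1 + LinearMap.inr k _ _ (T y).2 := by simp
    rw [h1, map_add]
    rfl
  -- Normalizing D'(T x) = 1 turns the vanishing minors into T u = D'(T u) T x, tested against every
  -- linear form D.
  obtain ⟨D', hD'⟩ := Projective.exists_dual_eq_one k (fun h => hx (hT h))
  have h0 : T (u - D' (T u) • x) = 0 := by
    refine (Module.forall_dual_apply_eq_zero_iff k _).1 fun D => ?_
    rw [← hp, map_sub, map_smul, hp, hp]
    have h1 := pairing_mul_comm hgg hx hη hw (D ∘ₗ LinearMap.inl k _ _) (D' ∘ₗ LinearMap.inl k _ _)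
      (D ∘ₗ LinearMap.inr k _ _) (D' ∘ₗ LinearMap.inr k _ _)
    rw [hp, hp, hp, hp, hD', one_mul] at h1
    rw [h1, smul_eq_mul, mul_comm, sub_self]
  have h1 := hT h0
  have h2 := congrArg f h1
  rw [map_sub, map_smul, hf, hfu, map_zero, zero_sub, smul_eq_mul, mul_one, neg_eq_zero] at h2
  rw [h2, zero_smul, sub_zero] at h1
  rw [h1, map_zero] at hgu
  exact zero_ne_one hgu

end generated

/-! ### Generation of trivial sheaves by constant sections -/

section trivialSheaf

variable {W : Type u} [AddCommGroup W] [Module k W] {l : ℤ}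

/-- A section of `𝓗om_k(W, 𝒪)` is a combination of the constant sections. -/
lemma eq_sum_smul_constSection {ι : Type*} [Fintype ι] (b : Module.Basis ι k W) (hl : 0 = l)
    {U : (ProjSpace k n).Opens} (s : Γ(homSheaf (k := k) n W l, U)) :
    ∃ r : ι → Γ(ProjSpace k n, U), s = ∑ i, r i • constSection hl (b.coord i) := by
  subst hl
  choose r hr using fun i => exists_structure_section (isLocallyFraction_value s (b i))
  refine ⟨r, section_ext fun x hx w => ?_⟩
  have h1 (T : Finset ι) : value (∑ i ∈ T, (show Γ(ProjSpace k n, U) from r i) •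
      constSection (n := n) (U := U) rfl (b.coord i)) x hx w =
      ∑ i ∈ T, value s x hx (b i) * algebraMap k (Loc k n x) (b.coord i w) := by
    classical
    induction T using Finset.induction_on with
    | empty => rfl
    | insert a T ha ih =>
      rw [Finset.sum_insert ha, Finset.sum_insert ha, ← ih, ← value_constSection rfl _ x hx,
        ← hr a ⟨x, hx⟩]
      rfl
  refine Eq.trans ?_ (h1 Finset.univ).symm
  conv_lhs => rw [← b.sum_repr w, map_sum]
  refine Finset.sum_congr rfl fun i _ => ?_
  rw [map_smul, Algebra.smul_def, mul_comm]
  rfl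

/-- The constant sections generate `𝓗om_k(W, 𝒪)`. -/
lemma globallyGenerated_homSheaf [FiniteDimensional k W] (hl : 0 = l) :
    GloballyGenerated (homSheaf (k := k) n W l) := by
  refine globallyGenerated_of_hom_ext (I := W →ₗ[k] k)
    (fun A => PresheafOfModules.sectionsMk (fun U => constSection (U := U.unop) hl A)
      fun U V f => rfl) fun K g₁ g₂ h => ?_
  refine Scheme.Modules.hom_ext _ _ fun U => ?_
  ext s
  obtain ⟨r, rfl⟩ := eq_sum_smul_constSection (Module.finBasis k W) hl s
  have h1 (g : homSheaf (k := k) n W l ⟶ K) : g.app U (∑ i, r i •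
      constSection hl ((Module.finBasis k W).coord i)) = ∑ i, r i • K.presheaf.map
        (homOfLE le_top : U ⟶ ⊤).op (g.app ⊤ (constSection hl ((Module.finBasis k W).coord i))) := by
    refine (map_sum (g.app U).hom _ _).trans (Finset.sum_congr rfl fun i _ => ?_)
    refine (Scheme.Modules.Hom.app_smul g _ _).trans (congrArg (r i • ·) ?_)
    exact (map_app g (homOfLE le_top : U ⟶ ⊤)
      (constSection hl ((Module.finBasis k W).coord i))).symm
  refine (h1 g₁).trans ((Finset.sum_congr rfl fun i _ => ?_).trans (h1 g₂).symm)
  exact congrArg (fun z => r i • K.presheaf.map (homOfLE le_top : U ⟶ ⊤).op z)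
    (h ((Module.finBasis k W).coord i))

lemma GloballyGenerated.of_epi {X : Scheme.{u}} {M N : X.Modules} (h : GloballyGenerated M)
    (f : M ⟶ N) [Epi f] : GloballyGenerated N := by
  obtain ⟨σ⟩ := h
  have : Epi (C := SheafOfModules X.ringCatSheaf) f := ‹Epi f›
  exact ⟨σ.ofEpi f⟩

end trivialSheaf

/-! ### Local exactness of the Koszul complex -/

section exactness

variable {l : ℤ} {U : (ProjSpace k n).Opens} {q : ℕ}

/-- The Koszul complex is locally exact. -/
lemma exists_koszulD_eq (γ : Γ(E k n (q + 1) l, U))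
    (h : ∀ p (hp : p ∈ U) (η : ⋀[k]^q (Vec k n)), ∑ t : Fin (n + 1),
      algebraMap (CoordRing k n) (Loc k n p) (MvPolynomial.X t) *
        value γ p hp (wedge (add_comm 1 q) (ofVec (Pi.single t 1)) η) = 0)
    {x : ProjSpace k n} (hx : x ∈ U) :
    ∃ (V : (ProjSpace k n).Opens) (j : V ⟶ U) (C : Γ(E k n (q + 1 + 1) (l - 1), V)), x ∈ V ∧
      (koszulD (q + 1) l).app V C = (E k n (q + 1) l).presheaf.map j.op γ := by
  obtain ⟨t, ht⟩ := exists_X_mem_outside x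
  let V : (ProjSpace k n).Opens := U ⊓ nonvanishing (MvPolynomial.X t)
  have hV (p : V) : MvPolynomial.X t ∈ outside p.1 := p.2.2
  have hf : (isLocallyFraction k n (-1)).pred (U := V) fun p =>
      Localization.mk (1 : CoordRing k n) ⟨MvPolynomial.X t, hV p⟩ := fun p =>
    ⟨V, p.2, 𝟙 _, 0, 1, by norm_num, 1, MvPolynomial.X t, SetLike.one_mem_graded _,
      (MvPolynomial.mem_homogeneousSubmodule _ _).2 (MvPolynomial.isHomogeneous_X k t),
      fun y => hV y, fun y => rfl⟩
  -- The contracting homotopy on D(X_t): precompose with contraction by the t-th coordinate and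
  -- divide by X_t. The Leibniz rule gives γ plus a term that the cycle condition kills.
  let C : Γ(homSheaf (k := k) n (⋀[k]^(q + 1 + 1) (Vec k n)) (l - 1), V) := mkSection
    (fun p => LinearMap.mulLeft k (Localization.mk (1 : CoordRing k n) ⟨MvPolynomial.X t, hV p⟩) ∘ₗ
      value γ p.1 p.2.1 ∘ₗ interior (LinearMap.proj t) (q + 1))
    (fun w => locFrac_mul (show (-1 : ℤ) + l = l - 1 by ring) hf
      ((isLocallyFraction k n l).res (Opens.infLELeft U _ : V ⟶ U) _
        (isLocallyFraction_value γ (interior (LinearMap.proj t) (q + 1) w))))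
  have hC (p) (hp : p ∈ V) (ζ) : value C p hp ζ =
      Localization.mk (1 : CoordRing k n) ⟨MvPolynomial.X t, hV ⟨p, hp⟩⟩ *
        value γ p hp.1 (interior (LinearMap.proj t) (q + 1) ζ) := rfl
  refine ⟨V, Opens.infLELeft _ _, C, ⟨hx, ht⟩, section_ext fun p hp η => ?_⟩
  refine (value_koszulD _ _ p hp η).trans ?_
  have hinv : Localization.mk (1 : CoordRing k n) ⟨MvPolynomial.X t, hV ⟨p, hp⟩⟩ *
      algebraMap (CoordRing k n) (Loc k n p) (MvPolynomial.X t) = 1 := by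
    rw [← Localization.mk_one_eq_algebraMap, Localization.mk_mul, one_mul, mul_one]
    exact Localization.mk_self (⟨MvPolynomial.X t, hV ⟨p, hp⟩⟩ : outside p)
  have h1 (s : Fin (n + 1)) : algebraMap (CoordRing k n) (Loc k n p) (MvPolynomial.X s) *
      value C p hp (wedge (add_comm 1 (q + 1)) (ofVec (Pi.single s 1)) η) =
      (if s = t then value γ p hp.1 η else 0) -
        Localization.mk (1 : CoordRing k n) ⟨MvPolynomial.X t, hV ⟨p, hp⟩⟩ *
          (algebraMap (CoordRing k n) (Loc k n p) (MvPolynomial.X s) *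
            value γ p hp.1 (wedge (add_comm 1 q) (ofVec (Pi.single s 1))
              (interior (LinearMap.proj t) q η))) := by
    refine (congrArg (_ * ·) (hC p hp _)).trans ?_
    rw [interior_wedge, map_sub, map_smul, mul_sub, mul_sub, ← mul_assoc, mul_left_comm]
    refine congrArg (· - _) ?_
    rw [LinearMap.proj_apply, Pi.single_apply]
    by_cases hst : s = t
    · subst hst
      rw [if_pos rfl, if_pos rfl, one_smul, mul_comm (algebraMap _ _ _), hinv, one_mul]
    · rw [if_neg hst, if_neg (Ne.symm hst), zero_smul, mul_zero]
  refine (Finset.sum_congr rfl fun s _ => h1 s).trans ?_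
  rw [Finset.sum_sub_distrib, ← Finset.mul_sum, h p hp.1, mul_zero, sub_zero,
    Finset.sum_ite_eq' Finset.univ t, if_pos (Finset.mem_univ t)]
  rfl

end exactness

/-! ### The kernel of ε as a quotient of a trivial sheaf -/

section kernel

variable {ω : ⋀[k]^2 (Vec k 4)} {v : Vec k 4} {U : (ProjSpace k 4).Opens}

/-- The pairs `(y ∧ ω, y ∧ v)`. -/
def relations (ω : ⋀[k]^2 (Vec k 4)) (v : Vec k 4) :
    Submodule k (⋀[k]^3 (Vec k 4) × ⋀[k]^2 (Vec k 4)) :=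
  Submodule.span k (Set.range fun y : Vec k 4 =>
    (wedge (add_comm 1 2) (ofVec y) ω, wedge (add_comm 1 1) (ofVec y) (ofVec v)))

/-- The pairs of forms that are killed by the contraction with `(ω, v)`, as a sheaf. -/
def compatiblePairs (ω : ⋀[k]^2 (Vec k 4)) (v : Vec k 4) : (ProjSpace k 4).Modules :=
  homSheaf 4 ((⋀[k]^3 (Vec k 4) × ⋀[k]^2 (Vec k 4)) ⧸ relations ω v) (1 - 1)

lemma globallyGenerated_compatiblePairs : GloballyGenerated (compatiblePairs ω v) :=
  globallyGenerated_homSheaf (by norm_num)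

variable (ω v) in
/-- The first components of the compatible pairs. -/
def compatiblePairsFst : compatiblePairs ω v ⟶ E k 4 (2 + 1) (1 - 1) :=
  precomp (1 - 1) ((relations ω v).mkQ ∘ₗ LinearMap.inl k _ _)

variable (ω v) in
/-- The second components of the compatible pairs. -/
def compatiblePairsSnd : compatiblePairs ω v ⟶ E k 4 (1 + 1) (1 - 1) :=
  precomp (1 - 1) ((relations ω v).mkQ ∘ₗ LinearMap.inr k _ _)

lemma mkQ_inl_add_mkQ_inr {M N P : Type*} [AddCommGroup M] [Module k M] [AddCommGroup N]
    [Module k N] [AddCommGroup P] [Module k P] {R : Submodule k (M × N)} (φ : (M × N) ⧸ R →ₗ[k] P)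
    {a : M} {b : N} (h : (a, b) ∈ R) :
    φ ((R.mkQ ∘ₗ LinearMap.inl k M N) a) + φ ((R.mkQ ∘ₗ LinearMap.inr k M N) b) = 0 := by
  rw [LinearMap.comp_apply, LinearMap.comp_apply, ← map_add, ← map_add, LinearMap.inl_apply,
    LinearMap.inr_apply, Prod.mk_add_mk, add_zero, zero_add, Submodule.mkQ_apply,
    (Submodule.Quotient.mk_eq_zero _).2 h, map_zero]

lemma compatiblePairs_relation (s : Γ(compatiblePairs ω v, U)) (p : ProjectiveSpectrum (grading k 4))
    (hp : p ∈ U) (y : Vec k 4) :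
    value ((compatiblePairsFst ω v).app U s) p hp (wedge (add_comm 1 2) (ofVec y) ω) +
      value ((compatiblePairsSnd ω v).app U s) p hp (wedge (add_comm 1 1) (ofVec y) (ofVec v)) = 0 :=
  mkQ_inl_add_mkQ_inr (value (l := 1 - 1) s p hp) (Submodule.subset_span ⟨y, rfl⟩)

lemma exists_compatiblePair (a : Γ(E k 4 (2 + 1) (1 - 1), U)) (b : Γ(E k 4 (1 + 1) (1 - 1), U))
    (h : ∀ p (hp : p ∈ U) y, value a p hp (wedge (add_comm 1 2) (ofVec y) ω) +
      value b p hp (wedge (add_comm 1 1) (ofVec y) (ofVec v)) = 0) :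
    ∃ s, (compatiblePairsFst ω v).app U s = a ∧ (compatiblePairsSnd ω v).app U s = b := by
  have hle (p : U) : relations ω v ≤
      LinearMap.ker ((value a p.1 p.2).coprod (value b p.1 p.2)) := by
    refine Submodule.span_le.2 ?_
    rintro _ ⟨y, rfl⟩
    exact h p.1 p.2 y
  refine ⟨mkSection (W := (⋀[k]^3 (Vec k 4) × ⋀[k]^2 (Vec k 4)) ⧸ relations ω v) (l := 1 - 1)
    (fun p => (relations ω v).liftQ _ (hle p)) fun w => ?_, ?_, ?_⟩
  · obtain ⟨⟨w₁, w₂⟩, rfl⟩ := (relations ω v).mkQ_surjective w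
    exact locFrac_add (isLocallyFraction_value a w₁) (isLocallyFraction_value b w₂)
  · refine section_ext fun p hp η => ?_
    exact (congrArg (value a p hp η + ·) (map_zero (value b p hp))).trans (add_zero _)
  · refine section_ext fun p hp η => ?_
    exact (congrArg (· + value b p hp η) (map_zero (value a p hp))).trans (zero_add _)

/-- Applying ε to the differentials gives Σ X_t (a(e_t∧ω) + b(e_t∧v)), whose terms vanish one by
one. -/
lemma lift_compatiblePairs_epsilon :
    biprod.lift (compatiblePairsFst ω v ≫ omegaπ k 4 2 1)
      (compatiblePairsSnd ω v ≫ omegaπ k 4 1 1) ≫ epsilon k ω v 1 = 0 := by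
  rw [epsilon, biprod.lift_desc]
  refine Scheme.Modules.hom_ext _ _ fun U => ?_
  ext s
  refine valueO_ext fun p hp => ?_
  have h1 := valueO_contractO ω (toOmega ((compatiblePairsFst ω v).app U s)) p hp
  have h2 := valueO_contractO (ofVec v) (toOmega ((compatiblePairsSnd ω v).app U s)) p hp
  rw [omegaι_toOmega] at h1 h2
  refine (congrArg₂ (· + ·) (h1.trans (value_koszulD _ _ _ hp _))
    (h2.trans (value_koszulD _ _ _ hp _))).trans ?_
  rw [← Finset.sum_add_distrib]
  refine Finset.sum_eq_zero fun t _ => ?_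
  rw [← mul_add]
  exact (congrArg (_ * ·) (compatiblePairs_relation s p hp (Pi.single t 1))).trans (mul_zero _)

variable (ω v) in
/-- The kernel of `epsilon` receives the sheaf of compatible pairs. -/
def compatiblePairsToKernel : compatiblePairs ω v ⟶ kernel (epsilon k ω v 1) :=
  kernel.lift _ _ lift_compatiblePairs_epsilon

lemma toOmega_koszulD [CharZero k] {q : ℕ} {l : ℤ} {U : (ProjSpace k n).Opens}
    (C : Γ(E k n (q + 1 + 1) (l - 1 - 1), U)) :
    toOmega ((koszulD (q + 1) (l - 1)).app U C) = 0 := by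
  refine omegaι_injective ?_
  rw [omegaι_toOmega]
  refine section_ext fun p hp η => ?_
  have h := sum_value_omegaι (toOmega C) p hp η
  rw [omegaι_toOmega] at h
  refine (value_koszulD _ _ p hp η).trans (h.trans ?_)
  have h1 : omegaι (0 : Γ(Omega k n q l, U)) = 0 :=
    map_zero (Scheme.Modules.Hom.app (image.ι (koszulD (k := k) (n := n) q l)) U).hom
  rw [h1]
  rfl

/-- A pair of forms that is killed by the contraction with `(ω, v)` up to exact forms can be
corrected by exact forms. -/
lemma exists_correction (hN : IsNormalForm ω v) (a : Γ(E k 4 (2 + 1) (1 - 1), U))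
    (b : Γ(E k 4 (1 + 1) (1 - 1), U))
    (h : ∀ p (hp : p ∈ U), ∑ t : Fin 5, algebraMap (CoordRing k 4) (Loc k 4 p) (MvPolynomial.X t) *
      (value a p hp (wedge (add_comm 1 2) (ofVec (Pi.single t 1)) ω) +
        value b p hp (wedge (add_comm 1 1) (ofVec (Pi.single t 1)) (ofVec v))) = 0)
    {x : ProjSpace k 4} (hx : x ∈ U) :
    ∃ (V : (ProjSpace k 4).Opens) (j : V ⟶ U) (C₄ : Γ(E k 4 (2 + 1 + 1) (1 - 1 - 1), V))
      (C₃ : Γ(E k 4 (1 + 1 + 1) (1 - 1 - 1), V)), x ∈ V ∧ ∀ p (hp : p ∈ V) y,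
        value a p (j.le hp) (wedge (add_comm 1 2) (ofVec y) ω) -
          value ((koszulD 3 (1 - 1)).app V C₄) p hp (wedge (add_comm 1 2) (ofVec y) ω) +
        (value b p (j.le hp) (wedge (add_comm 1 1) (ofVec y) (ofVec v)) -
          value ((koszulD 2 (1 - 1)).app V C₃) p hp (wedge (add_comm 1 1) (ofVec y) (ofVec v))) = 0 := by
  obtain ⟨g₄, g₃, hg⟩ := exists_leftInverse_two hN
  let γ : Γ(E k 4 (0 + 1) (1 - 1), U) :=
    (contractE (show 2 + 1 = 2 + 1 by rfl) ω (1 - 1)).app U a -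
      (contractE (show 1 + 1 = 1 + 1 by rfl) (ofVec v) (1 - 1)).app U b
  have hγ (p) (hp : p ∈ U) (ζ : ⋀[k]^1 (Vec k 4)) : value γ p hp ζ =
      value a p hp (wedge (show 2 + 1 = 3 by rfl) ω ζ) -
        value b p hp (wedge (show 1 + 1 = 2 by rfl) (ofVec v) ζ) := rfl
  have hγ' (p) (hp : p ∈ U) (y) : value γ p hp (ofVec y) =
      value a p hp (wedge (add_comm 1 2) (ofVec y) ω) +
        value b p hp (wedge (add_comm 1 1) (ofVec y) (ofVec v)) := by
    have h1 : wedge (show 2 + 1 = 3 by rfl) ω (ofVec y) = wedge (add_comm 1 2) (ofVec y) ω := by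
      apply Subtype.ext
      rw [coe_wedge, coe_wedge_ofVec, coe_ofVec, ι_mul_two_comm]
    have h2 : wedge (show 1 + 1 = 2 by rfl) (ofVec v) (ofVec y) =
        - wedge (add_comm 1 1) (ofVec y) (ofVec v) := by
      apply Subtype.ext
      rw [Submodule.coe_neg, coe_wedge_ofVec, coe_wedge_ofVec, coe_ofVec, coe_ofVec,
        mul_ι_anticomm]
    rw [hγ, h1, h2, map_neg, sub_neg_eq_add]
  obtain ⟨V, j, C, hV, hC⟩ := exists_koszulD_eq γ (fun p hp η => by
    obtain ⟨c, hc⟩ := Submodule.mem_one.1 (show (η : ExteriorAlgebra k (Vec k 4)) ∈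
      (1 : Submodule k (ExteriorAlgebra k (Vec k 4))) from η.2)
    have h1 (t : Fin 5) : wedge (add_comm 1 0) (ofVec (Pi.single t 1)) η =
        c • ofVec (Pi.single t 1 : Vec k 4) := by
      apply Subtype.ext
      rw [coe_wedge_ofVec, Submodule.coe_smul, coe_ofVec, ← hc, Algebra.smul_def,
        Algebra.commutes]
    refine Eq.trans ?_ ((congrArg (c • ·) (h p hp)).trans (smul_zero c))
    rw [Finset.smul_sum]
    refine Finset.sum_congr rfl fun t _ => ?_
    refine (congrArg (fun z => _ * value γ p hp z) (h1 t)).trans ?_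
    rw [map_smul, mul_smul_comm]
    exact congrArg (fun z => c • (_ * z)) (hγ' p hp _)) hx
  -- With γ = dC, evaluating C on e_t∧y through the left inverse splits the defect into the
  -- contributions of d(C∘g₄) on y∧ω and of -d(C∘g₃) on y∧v.
  refine ⟨V, j, (precompE g₄ _).app V C, -(precompE g₃ _).app V C, hV, fun p hp y => ?_⟩
  have h1 : value ((koszulD 1 (1 - 1)).app V C) p hp (ofVec y) = value γ p (j.le hp) (ofVec y) := by
    have h2 := congrArg (fun z => value (l := 1 - 1) (W := ⋀[k]^1 (Vec k 4)) z p hp (ofVec y)) hC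
    exact h2
  have h2 := (value_koszulD 1 C p hp (ofVec y)).symm.trans (h1.trans (hγ' p (j.le hp) y))
  have h3 := value_koszulD 3 ((precompE g₄ _).app V C) p hp (wedge (add_comm 1 2) (ofVec y) ω)
  have h4 := value_koszulD 2 (-(precompE g₃ _).app V C) p hp
    (wedge (add_comm 1 1) (ofVec y) (ofVec v))
  have h5 (t : Fin 5) : value C p hp (wedge (add_comm 1 1) (ofVec (Pi.single t 1)) (ofVec y)) =
      value C p hp (g₄ (wedge (add_comm 1 3) (ofVec (Pi.single t 1))
        (wedge (add_comm 1 2) (ofVec y) ω))) -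
      value C p hp (g₃ (wedge (add_comm 1 2) (ofVec (Pi.single t 1))
        (wedge (add_comm 1 1) (ofVec y) (ofVec v)))) := by
    have h6 : wedge (show 2 + 2 = 4 by rfl) ω
        (wedge (add_comm 1 1) (ofVec (Pi.single t 1)) (ofVec y)) =
          wedge (add_comm 1 3) (ofVec (Pi.single t 1)) (wedge (add_comm 1 2) (ofVec y) ω) := by
      apply Subtype.ext
      rw [coe_wedge, coe_wedge_ofVec, coe_wedge_ofVec, coe_wedge_ofVec, coe_ofVec, ← mul_assoc,
        ι_mul_two_comm, mul_assoc, ι_mul_two_comm]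
    have h7 : wedge (show 1 + 2 = 3 by rfl) (ofVec v)
        (wedge (add_comm 1 1) (ofVec (Pi.single t 1)) (ofVec y)) =
          wedge (add_comm 1 2) (ofVec (Pi.single t 1))
            (wedge (add_comm 1 1) (ofVec y) (ofVec v)) := by
      apply Subtype.ext
      rw [coe_wedge_ofVec, coe_wedge_ofVec, coe_wedge_ofVec, coe_wedge_ofVec, coe_ofVec, coe_ofVec,
        ι_mul_ι_mul_swap, mul_ι_anticomm y v, mul_neg, neg_neg]
    have h8 := hg (wedge (add_comm 1 1) (ofVec (Pi.single t 1)) (ofVec y))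
    rw [h6, h7] at h8
    have h9 := congrArg (value C p hp) h8
    rw [map_sub] at h9
    exact h9.symm
  rw [sub_add_sub_comm, ← h2]
  refine sub_eq_zero.2 (Eq.trans ?_ (congrArg₂ (· + ·) h3 h4).symm)
  rw [← Finset.sum_add_distrib]
  refine Finset.sum_congr rfl fun t _ => ?_
  refine (congrArg (_ * ·) (h5 t)).trans ?_
  rw [← mul_add, sub_eq_add_neg]
  rfl

lemma toOmega_map {i : ℕ} {l : ℤ} {U V : (ProjSpace k n).Opens} (j : V ⟶ U)
    (a : Γ(E k n (i + 1) (l - 1), U)) :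
    toOmega ((E k n (i + 1) (l - 1)).presheaf.map j.op a) =
      (Omega k n i l).presheaf.map j.op (toOmega a) :=
  (map_app _ j a).symm

lemma compatiblePairsToKernel_fst (s : Γ(compatiblePairs ω v, U)) :
    Scheme.Modules.Hom.app (biprod.fst : Omega k 4 2 1 ⊞ Omega k 4 1 1 ⟶ _) U
      ((kernel.ι (epsilon k ω v 1)).app U ((compatiblePairsToKernel ω v).app U s)) =
        toOmega ((compatiblePairsFst ω v).app U s) := by
  have h : (compatiblePairsToKernel ω v ≫ kernel.ι (epsilon k ω v 1)) ≫ biprod.fst =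
      compatiblePairsFst ω v ≫ omegaπ k 4 2 1 := by
    rw [compatiblePairsToKernel, kernel.lift_ι, biprod.lift_fst]
  exact congrArg (fun φ => Scheme.Modules.Hom.app φ U s) h

lemma compatiblePairsToKernel_snd (s : Γ(compatiblePairs ω v, U)) :
    Scheme.Modules.Hom.app (biprod.snd : Omega k 4 2 1 ⊞ Omega k 4 1 1 ⟶ _) U
      ((kernel.ι (epsilon k ω v 1)).app U ((compatiblePairsToKernel ω v).app U s)) =
        toOmega ((compatiblePairsSnd ω v).app U s) := by
  have h : (compatiblePairsToKernel ω v ≫ kernel.ι (epsilon k ω v 1)) ≫ biprod.snd =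
      compatiblePairsSnd ω v ≫ omegaπ k 4 1 1 := by
    rw [compatiblePairsToKernel, kernel.lift_ι, biprod.lift_snd]
  exact congrArg (fun φ => Scheme.Modules.Hom.app φ U s) h

/-- A section of the kernel of `epsilon` that is given by a pair of Koszul differentials comes
locally from a compatible pair. -/
lemma exists_local_compatiblePair [CharZero k] (hN : IsNormalForm ω v)
    (s : Γ(kernel (epsilon k ω v 1), U))
    (a : Γ(E k 4 (2 + 1) (1 - 1), U)) (b : Γ(E k 4 (1 + 1) (1 - 1), U))
    (ha : toOmega a = Scheme.Modules.Hom.app (biprod.fst : Omega k 4 2 1 ⊞ Omega k 4 1 1 ⟶ _) U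
      ((kernel.ι (epsilon k ω v 1)).app U s))
    (hb : toOmega b = Scheme.Modules.Hom.app (biprod.snd : Omega k 4 2 1 ⊞ Omega k 4 1 1 ⟶ _) U
      ((kernel.ι (epsilon k ω v 1)).app U s)) {x : ProjSpace k 4} (hx : x ∈ U) :
    ∃ (V : (ProjSpace k 4).Opens) (j : V ⟶ U) (t : Γ(compatiblePairs ω v, V)), x ∈ V ∧
      (compatiblePairsToKernel ω v).app V t = (kernel (epsilon k ω v 1)).presheaf.map j.op s := by
  obtain ⟨V, j, C₄, C₃, hV, hC⟩ := exists_correction hN a b (fun p hp => by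
    have h := valueO_epsilon (ω := ω) (v := v) ((kernel.ι (epsilon k ω v 1)).app U s) p hp
    rw [app_kernel_ι, ← ha, ← hb, omegaι_toOmega, omegaι_toOmega] at h
    simp only [mul_add, Finset.sum_add_distrib]
    exact (congrArg₂ (· + ·) (value_koszulD 2 a p hp ω) (value_koszulD 1 b p hp (ofVec v))).symm.trans
      h.symm) hx
  -- Subtracting exact forms leaves the images in Ω^2 and Ω^1 unchanged because d² = 0.
  obtain ⟨t, ht₁, ht₂⟩ := exists_compatiblePair
    ((E k 4 (2 + 1) (1 - 1)).presheaf.map j.op a - (koszulD 3 (1 - 1)).app V C₄)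
    ((E k 4 (1 + 1) (1 - 1)).presheaf.map j.op b - (koszulD 2 (1 - 1)).app V C₃) hC
  refine ⟨V, j, t, hV, app_injective_of_mono (kernel.ι (epsilon k ω v 1)) V
    (biprod_section_ext ?_ ?_)⟩
  · rw [compatiblePairsToKernel_fst, ht₁, ← map_app, ← map_app, ← ha, ← toOmega_map]
    refine (map_sub (Scheme.Modules.Hom.app (omegaπ k 4 2 1) V).hom _ _).trans ?_
    exact (congrArg (_ - ·) (toOmega_koszulD C₄)).trans (sub_zero _)
  · rw [compatiblePairsToKernel_snd, ht₂, ← map_app, ← map_app, ← hb, ← toOmega_map]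
    refine (map_sub (Scheme.Modules.Hom.app (omegaπ k 4 1 1) V).hom _ _).trans ?_
    exact (congrArg (_ - ·) (toOmega_koszulD C₃)).trans (sub_zero _)

lemma epi_compatiblePairsToKernel [CharZero k] (hN : IsNormalForm ω v) :
    Epi (compatiblePairsToKernel ω v) := by
  refine epi_of_local_preimage _ fun U s x hx => ?_
  obtain ⟨V₁, j₁, a, hV₁, ha⟩ := exists_toOmega_eq (Scheme.Modules.Hom.app
    (biprod.fst : Omega k 4 2 1 ⊞ Omega k 4 1 1 ⟶ _) U ((kernel.ι (epsilon k ω v 1)).app U s)) hx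
  obtain ⟨V₂, j₂, b, hV₂, hb⟩ := exists_toOmega_eq (Scheme.Modules.Hom.app
    (biprod.snd : Omega k 4 2 1 ⊞ Omega k 4 1 1 ⟶ _) U ((kernel.ι (epsilon k ω v 1)).app U s)) hx
  let i₁ : V₁ ⊓ V₂ ⟶ V₁ := Opens.infLELeft V₁ V₂
  let i₂ : V₁ ⊓ V₂ ⟶ V₂ := Opens.infLERight V₁ V₂
  obtain ⟨V, j, t, hV, ht⟩ := exists_local_compatiblePair hN
    ((kernel (epsilon k ω v 1)).presheaf.map (i₁ ≫ j₁).op s)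
    ((E k 4 (2 + 1) (1 - 1)).presheaf.map i₁.op a) ((E k 4 (1 + 1) (1 - 1)).presheaf.map i₂.op b)
    (by rw [toOmega_map, ha, ← map_app, ← map_app, map_map])
    (by rw [toOmega_map, hb, ← map_app, ← map_app, map_map]; rfl) (x := x) ⟨hV₁, hV₂⟩
  refine ⟨V, j ≫ i₁ ≫ j₁, t, hV, ?_⟩
  rw [ht, map_map]

lemma globallyGenerated_of_isNormalForm [CharZero k] (hN : IsNormalForm ω v) :
    GloballyGenerated (kernel (epsilon k ω v 1)) := by
  have := epi_compatiblePairsToKernel hN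
  exact globallyGenerated_compatiblePairs.of_epi (compatiblePairsToKernel ω v)

end kernel

end

end PnKoszul

theorem lemmaL {k : Type u} [Field k] [IsAlgClosed k] [CharZero k]
    (ω : ⋀[k]^2 (Fin 5 → k)) (v : Fin 5 → k) :
    (Epi (PnKoszul.phi k ω v 0) ↔
      ∃ b : Module.Basis (Fin 5) k (Fin 5 → k),
        ω = exteriorPower.ιMulti k 2 ![b 0, b 1] + exteriorPower.ιMulti k 2 ![b 2, b 3] ∧
          v = b 4) ∧
    (Epi (PnKoszul.phi k ω v 0) ↔
      Function.Surjective (Scheme.Modules.Hom.app (PnKoszul.phi k ω v 1) ⊤)) ∧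
    (Epi (PnKoszul.epsilon k ω v 0) →
      (PnKoszul.GloballyGenerated (kernel (PnKoszul.epsilon k ω v 1)) ↔
        ∃ b : Module.Basis (Fin 5) k (Fin 5 → k),
          ω = exteriorPower.ιMulti k 2 ![b 0, b 1] + exteriorPower.ιMulti k 2 ![b 2, b 3] ∧
            v = b 4)) := by
  refine ⟨⟨PnKoszul.isNormalForm_of_epi_phi, fun h => PnKoszul.epi_phi_of_isNormalForm h 0⟩,
    ⟨fun h => PnKoszul.surjective_phi_of_isNormalForm (PnKoszul.isNormalForm_of_epi_phi h),
      fun h => PnKoszul.epi_phi_of_isNormalForm (PnKoszul.isNormalForm_of_surjective_phi h) 0⟩,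
    fun h => ⟨PnKoszul.isNormalForm_of_globallyGenerated h,
      PnKoszul.globallyGenerated_of_isNormalForm⟩⟩
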